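/- Let $0\le r\le m$ be integers, and let $V^{\mathbb C}_{r,m}=\{X\in\mathbb C^{m\times r}: X^*X=I_r\}$ be the complex Stiefel manifold, where $X^*=\bar X'$ is the conjugate transpose. Let $[\mathrm dX]$ be the normalized invariant measure on $V^{\mathbb C}_{r,m}$, that is, its unique probability measure invariant under left multiplication by unitary $m\times m$ matrices. For a complex $m\times r$ matrix $X$ of rank $r$, the orientation of $X$ is $H_X=X(X^*X)^{-1/2}\in V^{\mathbb C}_{r,m}$, the semi-unitary factor of the polar decomposition $X=H_X(X^*X)^{1/2}$. Let $Z$ be a random complex $m\times r$ matrix that has a density $f_Z$ with respect to Lebesgue measure on $\mathbb C^{m\times r}$, and suppose that $f_Z$ is invariant under right unitary transformations: for every unitary $r\times r$ matrix $Q$, $f_Z(XQ)=f_Z(X)$ for almost every $X$. Let $B$ be a nonsingular complex $m\times m$ matrix and set $Y=BZ$. Then $H_Z$ has a density with respect to $[\mathrm dX]$, and for every version $f_{H_Z}$ of this density, the orientation $H_Y$ of $Y$ has, with respect to $[\mathrm dX]$, the density $$f_{H_Y}(H)=|B^*B|^{-r}\,|W^*W|^{-m}\,f_{H_Z}(H_W),\qquad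 H\in V^{\mathbb C}_{r,m},$$ where $W=B^{-1}H$, $H_W=W(W^*W)^{-1/2}$ is the orientation of $W$, and $|\cdot|$ denotes the determinant. -/

import Mathlib

open MeasureTheory ProbabilityTheory
open scoped ENNReal Matrix MatrixOrder

/-- Matrices carry the product `σ`-algebra of their entries. -/
instance Matrix.instMeasurableSpacePi {m n α : Type*} [MeasurableSpace α] :
    MeasurableSpace (Matrix m n α) :=
  inferInstanceAs (MeasurableSpace (m → n → α))

/-- The Lebesgue measure `(dZ)` on a space of matrices: the product, over the entries, of the
Lebesgue measure of the scalars (for `ℂ`, the planar Lebesgue measure). -/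
noncomputable instance Matrix.instMeasureSpacePi {m n α : Type*} [Fintype m] [Fintype n]
    [MeasureSpace α] : MeasureSpace (Matrix m n α) where
  toMeasurableSpace := Matrix.instMeasurableSpacePi
  volume := (volume : Measure (m → n → α))

instance Matrix.instBorelSpaceComplex {m n : Type*} [Fintype m] [Fintype n] :
    BorelSpace (Matrix m n ℂ) :=
  inferInstanceAs (BorelSpace (m → n → ℂ))

instance Matrix.instCompactSpaceUnitaryGroup {m : ℕ} :
    CompactSpace (Matrix.unitaryGroup (Fin m) ℂ) := by
  suffices h : IsCompact {A : Matrix (Fin m) (Fin m) ℂ | A ∈ Matrix.unitaryGroup (Fin m) ℂ} from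
    isCompact_iff_compactSpace.mp h
  have hK : IsCompact (Set.univ.pi fun _ : Fin m => Set.univ.pi fun _ : Fin m =>
      Metric.closedBall (0 : ℂ) 1) :=
    isCompact_univ_pi fun _ => isCompact_univ_pi fun _ => isCompact_closedBall _ _
  have hC : IsClosed {A : Matrix (Fin m) (Fin m) ℂ | star A * A = 1} :=
    isClosed_eq (by fun_prop) continuous_const
  refine hK.of_isClosed_subset ?_ ?_
  · have h : {A : Matrix (Fin m) (Fin m) ℂ | A ∈ Matrix.unitaryGroup (Fin m) ℂ}
        = {A : Matrix (Fin m) (Fin m) ℂ | star A * A = 1} := by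
      ext A
      exact Matrix.mem_unitaryGroup_iff'
    rw [h]
    exact hC
  · intro A hA i _ j _
    simpa using entry_norm_bound_of_unitary hA i j

/-- The complex Stiefel manifold of `m × r` semi-unitary matrices. -/
def complexStiefel (m r : ℕ) : Set (Matrix (Fin m) (Fin r) ℂ) := {X | Xᴴ * X = 1}

/-- The normalized invariant measure `[dX]` of the complex Stiefel manifold, as a measure on
`m × r` matrices that is concentrated on the manifold: the law of the first `r` columns of a
unitary `m × m` matrix distributed according to the Haar probability measure. It is the unique
probability measure on the manifold that is invariant under left multiplication by unitary
matrices. -/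
noncomputable def stiefelMeasure {m r : ℕ} (hrm : r ≤ m) : Measure (Matrix (Fin m) (Fin r) ℂ) :=
  (Measure.haarMeasure (⊤ : TopologicalSpace.PositiveCompacts
    (Matrix.unitaryGroup (Fin m) ℂ))).map
      fun U : Matrix.unitaryGroup (Fin m) ℂ =>
        (U : Matrix (Fin m) (Fin m) ℂ).submatrix id (Fin.castLE hrm)

/-- The measure `stiefelMeasure` lives on the Stiefel manifold, so that only the values there of a
density with respect to it matter. -/
theorem stiefelMeasure_compl {m r : ℕ} (hrm : r ≤ m) :
    stiefelMeasure hrm (complexStiefel m r)ᶜ = 0 := by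
  have hC : IsClosed (complexStiefel m r) :=
    isClosed_eq (by fun_prop) continuous_const
  have hcont : Continuous fun U : Matrix.unitaryGroup (Fin m) ℂ =>
      (U : Matrix (Fin m) (Fin m) ℂ).submatrix id (Fin.castLE hrm) :=
    continuous_subtype_val.matrix_submatrix _ _
  have hempty : (fun U : Matrix.unitaryGroup (Fin m) ℂ =>
      (U : Matrix (Fin m) (Fin m) ℂ).submatrix id (Fin.castLE hrm)) ⁻¹'
        (complexStiefel m r)ᶜ = ∅ := by
    refine Set.eq_empty_of_forall_notMem fun U hU => hU ?_
    have h : (U : Matrix (Fin m) (Fin m) ℂ)ᴴ * (U : Matrix (Fin m) (Fin m) ℂ) = 1 :=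
      Matrix.mem_unitaryGroup_iff'.mp U.2
    have h2 := congrArg (fun A => A.submatrix (Fin.castLE hrm) (Fin.castLE hrm)) h
    simp only [Matrix.submatrix_one _ (Fin.castLE_injective hrm)] at h2
    exact h2
  rw [stiefelMeasure, Measure.map_apply hcont.measurable hC.measurableSet.compl, hempty,
    measure_empty]

/-- The orientation `H_Z = Z (Zᴴ Z)^(-1/2)` of the polar decomposition `Z = H_Z T_Z^(1/2)`,
`T_Z = Zᴴ Z`, of a complex matrix `Z` of full column rank. `CFC.sqrt` is the positive
semidefinite square root. -/
noncomputable def orientation {m r : ℕ} (Z : Matrix (Fin m) (Fin r) ℂ) :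
    Matrix (Fin m) (Fin r) ℂ :=
  Z * (CFC.sqrt (Zᴴ * Z))⁻¹

/-- The random element `X` has density `f` with respect to `μ`: `f` is a version of the
Radon-Nikodym derivative of the law of `X`. -/
structure HasDensity {Ω E : Type*} [MeasurableSpace Ω] [MeasurableSpace E]
    (X : Ω → E) (P : Measure Ω) (μ : Measure E) (f : E → ℝ≥0∞) : Prop where
  aemeasurable : AEMeasurable f μ
  hasLaw : HasLaw X (μ.withDensity f) P

/-! A right unitarily invariant law of `Z` makes the density of `H_Z` depend, up to null sets, only
on the column space. On functions of the column space, left multiplication by `B⁻¹` changes the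
Stiefel measure by the factor `|B*B|^(-r) |W*W|^(-m)`, and this factor is the theorem.

The Jacobian is found without the polar coordinate formula. The orientation of a uniform point of a
Frobenius ball is uniform on the Stiefel manifold (`setLIntegral_orientation_frobeniusBall`), by
uniqueness of the invariant measure (`lintegral_eq_of_unitary_invariant`). So Stiefel integrals are
Lebesgue integrals over the ball. The measure `|X*X|^(-m) dX` is invariant under `X ↦ X T` for
invertible `T`. For right invariant `k` and a suitable weight `w` of the Gram matrix, a Tonelli
argument over `T` shows that the integrals of `k(X) w(BX)` and `k(X) w(X)` against this measure
agree (`lintegral_gramWeight_comp_left_mul`). The linear substitution `Y = BX` then yields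
`RightInvariant.lintegral_stiefelMeasure_eq`.

For a general event, the test function and the density are first averaged over the right action of
the unitary group. This changes no integral, since the law of `Z` and the Stiefel measure are both
right invariant, and it changes the density only on a null set (`unitaryAverage_ae_eq`). That `H ↦
H_W` pulls null sets back to null sets makes the formula valid for every version of the density. -/

/-! ### Gram determinants and the polar decomposition. -/

section Algebra

open scoped ComplexOrder

variable {m r : ℕ}

/-- The modulus of the Gram determinant of a complex matrix. -/
noncomputable def gramDet (X : Matrix (Fin m) (Fin r) ℂ) : ℝ := ‖(Xᴴ * X).det‖

theorem gramDet_nonneg (X : Matrix (Fin m) (Fin r) ℂ) : 0 ≤ gramDet X := norm_nonneg _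

theorem gramDet_congr {l : ℕ} {X : Matrix (Fin m) (Fin r) ℂ} {Y : Matrix (Fin l) (Fin r) ℂ}
    (h : Xᴴ * X = Yᴴ * Y) : gramDet X = gramDet Y := by
  rw [gramDet, gramDet, h]

theorem gramDet_mul (X : Matrix (Fin m) (Fin r) ℂ) (T : Matrix (Fin r) (Fin r) ℂ) :
    gramDet (X * T) = gramDet X * ‖T.det‖ ^ 2 := by
  have h : (X * T)ᴴ * (X * T) = Tᴴ * (Xᴴ * X) * T := by
    rw [Matrix.conjTranspose_mul]; simp only [Matrix.mul_assoc]
  rw [gramDet, gramDet, h, Matrix.det_mul, Matrix.det_mul, Matrix.det_conjTranspose, norm_mul,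
    norm_mul, norm_star]
  ring

theorem gramDet_square (T : Matrix (Fin r) (Fin r) ℂ) : gramDet T = ‖T.det‖ ^ 2 := by
  rw [gramDet, Matrix.det_mul, Matrix.det_conjTranspose, norm_mul, norm_star, sq]

theorem det_gram_ne_zero {X : Matrix (Fin m) (Fin r) ℂ} (hX : gramDet X ≠ 0) :
    (Xᴴ * X).det ≠ 0 := by
  simpa [gramDet] using hX

/-- `XᴴX` and `X` have the same kernel, so this is full column rank. -/
theorem gramDet_ne_zero_iff_injective {X : Matrix (Fin m) (Fin r) ℂ} :
    gramDet X ≠ 0 ↔ Function.Injective X.mulVec := by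
  rw [gramDet, norm_ne_zero_iff, ← isUnit_iff_ne_zero, ← Matrix.isUnit_iff_isUnit_det,
    ← Matrix.mulVec_injective_iff_isUnit]
  constructor
  · intro h x y hxy
    apply h
    simp only [← Matrix.mulVec_mulVec]
    exact congrArg _ hxy
  · intro h x y hxy
    apply h
    rw [← sub_eq_zero, ← Matrix.mulVec_sub] at hxy ⊢
    exact Matrix.conjTranspose_mul_self_mulVec_eq_zero _ _ |>.mp hxy

theorem gramDet_left_mul_ne_zero {B : Matrix (Fin m) (Fin m) ℂ} (hB : B.det ≠ 0)
    {X : Matrix (Fin m) (Fin r) ℂ} (hX : gramDet X ≠ 0) : gramDet (B * X) ≠ 0 := by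
  rw [gramDet_ne_zero_iff_injective] at hX ⊢
  have hB' : Function.Injective B.mulVec :=
    Matrix.mulVec_injective_of_isUnit ((Matrix.isUnit_iff_isUnit_det _).2 hB.isUnit)
  intro x y h
  simp only [← Matrix.mulVec_mulVec] at h
  exact hX (hB' h)

theorem gramDet_of_mem_complexStiefel {X : Matrix (Fin m) (Fin r) ℂ}
    (hX : X ∈ complexStiefel m r) : gramDet X = 1 := by
  rw [complexStiefel, Set.mem_ofPred_eq] at hX
  simp [gramDet, hX]

/-- The positive semidefinite square root of the Gram matrix. -/
noncomputable def gramSqrt (X : Matrix (Fin m) (Fin r) ℂ) : Matrix (Fin r) (Fin r) ℂ :=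
  CFC.sqrt (Xᴴ * X)

theorem gram_nonneg (X : Matrix (Fin m) (Fin r) ℂ) : 0 ≤ Xᴴ * X :=
  Matrix.nonneg_iff_posSemidef.2 (Matrix.posSemidef_conjTranspose_mul_self X)

theorem gramSqrt_mul_self (X : Matrix (Fin m) (Fin r) ℂ) :
    gramSqrt X * gramSqrt X = Xᴴ * X :=
  CFC.sqrt_mul_sqrt_self _ (gram_nonneg X)

theorem gramSqrt_conjTranspose (X : Matrix (Fin m) (Fin r) ℂ) :
    (gramSqrt X)ᴴ = gramSqrt X :=
  (Matrix.nonneg_iff_posSemidef.1 (CFC.sqrt_nonneg (Xᴴ * X))).isHermitian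

theorem gram_gramSqrt (X : Matrix (Fin m) (Fin r) ℂ) :
    (gramSqrt X)ᴴ * gramSqrt X = Xᴴ * X := by
  rw [gramSqrt_conjTranspose, gramSqrt_mul_self]

theorem det_gramSqrt_ne_zero {X : Matrix (Fin m) (Fin r) ℂ} (hX : gramDet X ≠ 0) :
    (gramSqrt X).det ≠ 0 := by
  intro h
  apply det_gram_ne_zero hX
  rw [← gramSqrt_mul_self, Matrix.det_mul, h, zero_mul]

theorem orientation_eq (X : Matrix (Fin m) (Fin r) ℂ) : orientation X = X * (gramSqrt X)⁻¹ := rfl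

theorem orientation_mul_gramSqrt {X : Matrix (Fin m) (Fin r) ℂ} (hX : gramDet X ≠ 0) :
    orientation X * gramSqrt X = X := by
  rw [orientation_eq, Matrix.mul_assoc,
    Matrix.nonsing_inv_mul _ (det_gramSqrt_ne_zero hX).isUnit, Matrix.mul_one]

theorem orientation_mem {X : Matrix (Fin m) (Fin r) ℂ} (hX : gramDet X ≠ 0) :
    orientation X ∈ complexStiefel m r := by
  have hS := (det_gramSqrt_ne_zero hX).isUnit
  show (orientation X)ᴴ * orientation X = 1
  rw [orientation_eq, Matrix.conjTranspose_mul, Matrix.conjTranspose_nonsing_inv,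
    gramSqrt_conjTranspose, Matrix.mul_assoc, ← Matrix.mul_assoc Xᴴ, ← gramSqrt_mul_self,
    Matrix.mul_assoc, Matrix.mul_nonsing_inv _ hS, Matrix.mul_one, Matrix.nonsing_inv_mul _ hS]

theorem orientation_of_mem {X : Matrix (Fin m) (Fin r) ℂ} (hX : X ∈ complexStiefel m r) :
    orientation X = X := by
  have h : Xᴴ * X = 1 := hX
  rw [orientation, h, CFC.sqrt_one, inv_one, Matrix.mul_one]

theorem orientation_unitary_mul {U : Matrix (Fin m) (Fin m) ℂ}
    (hU : U ∈ Matrix.unitaryGroup (Fin m) ℂ) (X : Matrix (Fin m) (Fin r) ℂ) :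
    orientation (U * X) = U * orientation X := by
  have h : Uᴴ * U = 1 := Matrix.mem_unitaryGroup_iff'.1 hU
  have h2 : (U * X)ᴴ * (U * X) = Xᴴ * X := by
    rw [Matrix.conjTranspose_mul, Matrix.mul_assoc, ← Matrix.mul_assoc Uᴴ, h, Matrix.one_mul]
  rw [orientation, orientation, h2, Matrix.mul_assoc]

/-- The conjugate `Qᴴ (XᴴX)^(1/2) Q` is positive semidefinite and squares to the Gram matrix of
`XQ`, so it is its square root. No rank condition is needed. -/
theorem orientation_mul_unitary {Q : Matrix (Fin r) (Fin r) ℂ}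
    (hQ : Q ∈ Matrix.unitaryGroup (Fin r) ℂ) (X : Matrix (Fin m) (Fin r) ℂ) :
    orientation (X * Q) = orientation X * Q := by
  have h : Qᴴ * Q = 1 := Matrix.mem_unitaryGroup_iff'.1 hQ
  have h' : Q * Qᴴ = 1 := Matrix.mem_unitaryGroup_iff.1 hQ
  have hinv : Q⁻¹ = Qᴴ := Matrix.inv_eq_left_inv h
  have hinv' : Qᴴ⁻¹ = Q := Matrix.inv_eq_left_inv h'
  have hS : CFC.sqrt ((X * Q)ᴴ * (X * Q)) = Qᴴ * gramSqrt X * Q := by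
    apply CFC.sqrt_unique
    · calc Qᴴ * gramSqrt X * Q * (Qᴴ * gramSqrt X * Q)
          = Qᴴ * gramSqrt X * (Q * Qᴴ) * gramSqrt X * Q := by simp only [Matrix.mul_assoc]
        _ = Qᴴ * (gramSqrt X * gramSqrt X) * Q := by
          rw [h', Matrix.mul_one]; simp only [Matrix.mul_assoc]
        _ = (X * Q)ᴴ * (X * Q) := by
          rw [gramSqrt_mul_self, Matrix.conjTranspose_mul]; simp only [Matrix.mul_assoc]
    · rw [Matrix.nonneg_iff_posSemidef]
      exact (Matrix.nonneg_iff_posSemidef.1 (CFC.sqrt_nonneg (Xᴴ * X))).conjTranspose_mul_mul_same Q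
  rw [orientation, hS, orientation_eq, Matrix.mul_inv_rev, Matrix.mul_inv_rev, hinv, hinv',
    ← Matrix.mul_assoc, ← Matrix.mul_assoc, Matrix.mul_assoc X, h', Matrix.mul_one]

/-- Matrices of full column rank with the same column space have orientations that differ by a
unitary factor. -/
theorem exists_unitary_orientation_mul {X : Matrix (Fin m) (Fin r) ℂ}
    {T : Matrix (Fin r) (Fin r) ℂ} (hX : gramDet X ≠ 0) (hT : T.det ≠ 0) :
    ∃ Q ∈ Matrix.unitaryGroup (Fin r) ℂ, orientation (X * T) = orientation X * Q := by
  have hXT : gramDet (X * T) ≠ 0 := by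
    rw [gramDet_mul]; exact mul_ne_zero hX (pow_ne_zero _ (norm_ne_zero_iff.2 hT))
  have h : orientation (X * T) = orientation X * (gramSqrt X * T * (gramSqrt (X * T))⁻¹) := by
    rw [← Matrix.mul_assoc, ← Matrix.mul_assoc, orientation_mul_gramSqrt hX, orientation_eq]
  -- The factor is unitary because both orientations are semi-unitary: the first cancels from the
  -- Gram matrix of the second.
  refine ⟨_, Matrix.mem_unitaryGroup_iff'.2 ?_, h⟩
  have h1 : (orientation X)ᴴ * orientation X = 1 := orientation_mem hX
  have h2 : (orientation (X * T))ᴴ * orientation (X * T) = 1 := orientation_mem hXT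
  rw [h, Matrix.conjTranspose_mul, Matrix.mul_assoc, ← Matrix.mul_assoc _ (orientation X), h1,
    Matrix.one_mul] at h2
  exact h2

end Algebra

/-! ### Measurability of the orientation map. -/

section Measurability

variable {m r : ℕ}

theorem continuous_gramDet : Continuous (gramDet : Matrix (Fin m) (Fin r) ℂ → ℝ) := by
  unfold gramDet; fun_prop

@[fun_prop]
theorem measurable_gramDet : Measurable (gramDet : Matrix (Fin m) (Fin r) ℂ → ℝ) :=
  continuous_gramDet.measurable

section
open scoped Matrix.Norms.L2Operator

/-- The square root is continuous on nonnegative elements of a C*-algebra; the operator norm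
supplies that structure and is opened only here. -/
theorem continuous_gramSqrt :
    Continuous (gramSqrt : Matrix (Fin m) (Fin r) ℂ → Matrix (Fin r) (Fin r) ℂ) :=
  (CFC.continuousOn_sqrt (A := Matrix (Fin r) (Fin r) ℂ)).comp_continuous
    (f := fun X : Matrix (Fin m) (Fin r) ℂ => Xᴴ * X) (by fun_prop) gram_nonneg

end

/-- Inversion, set to `0` at singular matrices, is in general not continuous there, but Cramer's
formula holds everywhere with the convention `0⁻¹ = 0`. -/
theorem Matrix.measurable_nonsing_inv :
    Measurable fun A : Matrix (Fin r) (Fin r) ℂ => A⁻¹ := by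
  have h : (fun A : Matrix (Fin r) (Fin r) ℂ => A⁻¹) = fun A => A.det⁻¹ • A.adjugate := by
    ext1 A; rw [Matrix.inv_def, Ring.inverse_eq_inv']
  rw [h]
  refine measurable_pi_lambda _ fun i => measurable_pi_lambda _ fun j => ?_
  have h1 : Measurable fun A : Matrix (Fin r) (Fin r) ℂ => A.det :=
    (continuous_id.matrix_det).measurable
  have h2 : Measurable fun A : Matrix (Fin r) (Fin r) ℂ => A.adjugate i j :=
    (continuous_id.matrix_adjugate.matrix_elem i j).measurable
  exact h1.inv.mul h2

instance : SecondCountableTopology (Matrix (Fin m) (Fin r) ℂ) :=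
  inferInstanceAs (SecondCountableTopology (Fin m → Fin r → ℂ))

theorem Matrix.measurable_mul_prod {l : ℕ} :
    Measurable fun p : Matrix (Fin m) (Fin r) ℂ × Matrix (Fin r) (Fin l) ℂ => p.1 * p.2 :=
  (continuous_fst.matrix_mul continuous_snd).measurable

@[fun_prop]
theorem Measurable.matrix_mul_complex {α : Type*} [MeasurableSpace α] {l : ℕ}
    {f : α → Matrix (Fin m) (Fin r) ℂ} {g : α → Matrix (Fin r) (Fin l) ℂ}
    (hf : Measurable f) (hg : Measurable g) : Measurable fun x => f x * g x :=
  Matrix.measurable_mul_prod.comp (hf.prodMk hg)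

@[fun_prop]
theorem Measurable.matrix_inv_complex {α : Type*} [MeasurableSpace α]
    {f : α → Matrix (Fin r) (Fin r) ℂ} (hf : Measurable f) : Measurable fun x => (f x)⁻¹ :=
  Matrix.measurable_nonsing_inv.comp hf

@[fun_prop]
theorem measurable_orientation :
    Measurable (orientation : Matrix (Fin m) (Fin r) ℂ → Matrix (Fin m) (Fin r) ℂ) := by
  have h : (orientation : Matrix (Fin m) (Fin r) ℂ → Matrix (Fin m) (Fin r) ℂ)
      = fun X => X * (gramSqrt X)⁻¹ := funext orientation_eq
  rw [h]
  have := (continuous_gramSqrt (m := m) (r := r)).measurable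
  fun_prop

end Measurability

/-! ### Linear changes of variables and the null set of rank-deficient matrices. -/

section Lebesgue

variable {m r : ℕ}

theorem isAddHaarMeasure_volume_pi_pi :
    (volume : Measure (Fin m → Fin r → ℂ)).IsAddHaarMeasure :=
  haveI : (volume : Measure (Fin r → ℂ)).IsAddHaarMeasure := inferInstance
  Measure.pi.isAddHaarMeasure fun _ : Fin m => (volume : Measure (Fin r → ℂ))

instance : (volume : Measure (Matrix (Fin m) (Fin r) ℂ)).IsAddHaarMeasure :=
  isAddHaarMeasure_volume_pi_pi

instance : SigmaFinite (volume : Measure (Matrix (Fin m) (Fin r) ℂ)) :=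
  inferInstanceAs (SigmaFinite (volume : Measure (Fin m → Fin r → ℂ)))

theorem Complex.abs_det_restrictScalars {V : Type*} [AddCommGroup V] [Module ℂ V]
    [FiniteDimensional ℂ V] (f : V →ₗ[ℂ] V) :
    |LinearMap.det (f.restrictScalars ℝ)| = ‖LinearMap.det f‖ ^ 2 := by
  rw [LinearMap.det_restrictScalars, Algebra.norm_complex_apply, Complex.normSq_eq_norm_sq,
    abs_of_nonneg (by positivity)]

theorem lintegral_comp_complexLinearMap {F : Matrix (Fin m) (Fin r) ℂ → ℝ≥0∞} (hF : Measurable F)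
    (f : Matrix (Fin m) (Fin r) ℂ →ₗ[ℂ] Matrix (Fin m) (Fin r) ℂ) (hf : LinearMap.det f ≠ 0)
    (hfm : Measurable f) :
    ∫⁻ X, F (f X) = ENNReal.ofReal ((‖LinearMap.det f‖ ^ 2)⁻¹) * ∫⁻ X, F X := by
  have h0 : LinearMap.det (f.restrictScalars ℝ) ≠ 0 := by
    rw [← abs_ne_zero, Complex.abs_det_restrictScalars]
    exact pow_ne_zero _ (norm_ne_zero_iff.2 hf)
  have := isAddHaarMeasure_volume_pi_pi (m := m) (r := r)
  have h : Measure.map f (volume : Measure (Matrix (Fin m) (Fin r) ℂ))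
      = ENNReal.ofReal |(LinearMap.det (f.restrictScalars ℝ))⁻¹| • volume :=
    Measure.map_linearMap_addHaar_eq_smul_addHaar (E := Fin m → Fin r → ℂ) volume
      (f := f.restrictScalars ℝ) h0
  rw [← lintegral_map hF hfm, h, lintegral_smul_measure, abs_inv,
    Complex.abs_det_restrictScalars, smul_eq_mul]

/-- Right multiplication as a linear map. -/
noncomputable def Matrix.rightMulLinear (T : Matrix (Fin r) (Fin r) ℂ) :
    Matrix (Fin m) (Fin r) ℂ →ₗ[ℂ] Matrix (Fin m) (Fin r) ℂ :=
  LinearMap.pi fun i => T.vecMulLinear.comp (LinearMap.proj i)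

theorem Matrix.rightMulLinear_apply (T : Matrix (Fin r) (Fin r) ℂ)
    (X : Matrix (Fin m) (Fin r) ℂ) : Matrix.rightMulLinear T X = X * T := by
  ext i j
  rfl

/-- Right multiplication acts on each of the `m` rows separately, by the same map. -/
theorem Matrix.det_rightMulLinear (T : Matrix (Fin r) (Fin r) ℂ) :
    LinearMap.det (Matrix.rightMulLinear T : Matrix (Fin m) (Fin r) ℂ →ₗ[ℂ] _) = T.det ^ m := by
  have h1 : LinearMap.det T.vecMulLinear = T.det := by
    rw [← Matrix.det_transpose, ← LinearMap.det_toLin']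
    congr 1
    refine LinearMap.ext fun x => ?_
    simp only [Matrix.vecMulLinear_apply, Matrix.toLin'_apply, Matrix.mulVec_transpose]
  refine (LinearMap.det_pi fun _ : Fin m => T.vecMulLinear).trans ?_
  simp [h1]

theorem lintegral_mul_right {F : Matrix (Fin m) (Fin r) ℂ → ℝ≥0∞} (hF : Measurable F)
    {T : Matrix (Fin r) (Fin r) ℂ} (hT : T.det ≠ 0) :
    ∫⁻ X : Matrix (Fin m) (Fin r) ℂ, F (X * T)
      = ENNReal.ofReal ((‖T.det‖ ^ (2 * m))⁻¹) * ∫⁻ X, F X := by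
  have hm : Measurable (Matrix.rightMulLinear T : Matrix (Fin m) (Fin r) ℂ →ₗ[ℂ] _) := by
    rw [show (⇑(Matrix.rightMulLinear T : Matrix (Fin m) (Fin r) ℂ →ₗ[ℂ] _)) = fun X => X * T
      from funext fun X => Matrix.rightMulLinear_apply T X]
    fun_prop
  have h := lintegral_comp_complexLinearMap hF (Matrix.rightMulLinear T)
    (by rw [Matrix.det_rightMulLinear]; exact pow_ne_zero _ hT) hm
  simp only [Matrix.rightMulLinear_apply, Matrix.det_rightMulLinear, norm_pow] at h
  rw [h, ← pow_mul, mul_comm m 2]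

/-- Transposition conjugates left multiplication by `B` to right multiplication by `Bᵀ`, now with
`r` rows. -/
theorem lintegral_mul_left {F : Matrix (Fin m) (Fin r) ℂ → ℝ≥0∞} (hF : Measurable F)
    {B : Matrix (Fin m) (Fin m) ℂ} (hB : B.det ≠ 0) :
    ∫⁻ X : Matrix (Fin m) (Fin r) ℂ, F (B * X)
      = ENNReal.ofReal ((‖B.det‖ ^ (2 * r))⁻¹) * ∫⁻ X, F X := by
  let e : Matrix (Fin r) (Fin m) ℂ ≃ₗ[ℂ] Matrix (Fin m) (Fin r) ℂ :=
    Matrix.transposeLinearEquiv (Fin r) (Fin m) ℂ ℂ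
  let f : Matrix (Fin m) (Fin r) ℂ →ₗ[ℂ] Matrix (Fin m) (Fin r) ℂ :=
    e.toLinearMap ∘ₗ (Matrix.rightMulLinear Bᵀ ∘ₗ e.symm.toLinearMap)
  have hf : ∀ X, f X = B * X := fun X => by
    show (Matrix.rightMulLinear Bᵀ Xᵀ)ᵀ = B * X
    rw [Matrix.rightMulLinear_apply, Matrix.transpose_mul, Matrix.transpose_transpose,
      Matrix.transpose_transpose]
  have hdet : LinearMap.det f = B.det ^ r := by
    rw [← Matrix.det_transpose B, ← Matrix.det_rightMulLinear]
    exact LinearMap.det_conj _ e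
  have hm : Measurable f := by
    rw [show ⇑f = fun X => B * X from funext hf]
    fun_prop
  have h := lintegral_comp_complexLinearMap hF f (by rw [hdet]; exact pow_ne_zero _ hB) hm
  simp only [hf, hdet, norm_pow] at h
  rw [h, ← pow_mul, mul_comm r 2]

theorem norm_det_of_mem_unitaryGroup {U : Matrix (Fin m) (Fin m) ℂ}
    (hU : U ∈ Matrix.unitaryGroup (Fin m) ℂ) : ‖U.det‖ = 1 :=
  CStarRing.norm_of_mem_unitary (Matrix.det_of_mem_unitary hU)

theorem lintegral_unitary_mul {F : Matrix (Fin m) (Fin r) ℂ → ℝ≥0∞} (hF : Measurable F)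
    {U : Matrix (Fin m) (Fin m) ℂ} (hU : U ∈ Matrix.unitaryGroup (Fin m) ℂ) :
    ∫⁻ X : Matrix (Fin m) (Fin r) ℂ, F (U * X) = ∫⁻ X, F X := by
  have h := norm_det_of_mem_unitaryGroup hU
  rw [lintegral_mul_left hF (by rw [← norm_ne_zero_iff, h]; exact one_ne_zero), h]
  simp

theorem lintegral_mul_unitary {F : Matrix (Fin m) (Fin r) ℂ → ℝ≥0∞} (hF : Measurable F)
    {Q : Matrix (Fin r) (Fin r) ℂ} (hQ : Q ∈ Matrix.unitaryGroup (Fin r) ℂ) :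
    ∫⁻ X : Matrix (Fin m) (Fin r) ℂ, F (X * Q) = ∫⁻ X, F X := by
  have h := norm_det_of_mem_unitaryGroup hQ
  rw [lintegral_mul_right hF (by rw [← norm_ne_zero_iff, h]; exact one_ne_zero), h]
  simp

/-- Almost every `m × r` matrix with `r ≤ m` has full column rank. -/
theorem ae_gramDet_ne_zero (hrm : r ≤ m) :
    ∀ᵐ X : Matrix (Fin m) (Fin r) ℂ, gramDet X ≠ 0 := by
  set c := Fin.castLE hrm
  let E : Matrix (Fin m) (Fin r) ℂ := (1 : Matrix (Fin m) (Fin m) ℂ).submatrix id c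
  let N : Set (Matrix (Fin m) (Fin r) ℂ) := {X | gramDet X = 0}
  have hN : MeasurableSet N := measurable_gramDet (measurableSet_singleton 0)
  -- Along `t ↦ X + tE` the top square block is `X₁ + t`, where `X₁` is that block of `X`. Its
  -- determinant is the characteristic polynomial of `-X₁` at `t`: monic, hence with finitely many
  -- roots.
  have hfin : ∀ X : Matrix (Fin m) (Fin r) ℂ, {t : ℝ | X + (t : ℂ) • E ∈ N}.Finite := by
    intro X
    let p : Polynomial ℂ := (-(X.submatrix c id)).charpoly
    have hp : p ≠ 0 := (Matrix.charpoly_monic _).ne_zero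
    have hs : {t : ℝ | X + (t : ℂ) • E ∈ N} ⊆ (fun t : ℝ => (t : ℂ)) ⁻¹' {z | p.IsRoot z} := by
      intro t ht
      by_contra hroot
      have hdet : (((X + (t : ℂ) • E)).submatrix c id).det ≠ 0 := by
        have hE : E.submatrix c id = 1 := by
          rw [Matrix.submatrix_submatrix]
          exact Matrix.submatrix_one _ (Fin.castLE_injective hrm)
        have : p.eval (t : ℂ) ≠ 0 := hroot
        rw [Matrix.eval_charpoly, sub_neg_eq_add] at this
        rw [Matrix.submatrix_add, Matrix.submatrix_smul, Pi.add_apply, Pi.add_apply, Pi.smul_apply,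
          Pi.smul_apply, hE, add_comm, Matrix.smul_one_eq_diagonal]
        exact this
      have hinj : Function.Injective ((X + (t : ℂ) • E).submatrix c id).mulVec :=
        Matrix.mulVec_injective_of_isUnit ((Matrix.isUnit_iff_isUnit_det _).2 hdet.isUnit)
      refine gramDet_ne_zero_iff_injective.2 (fun x y hxy => hinj ?_) ht
      funext i
      exact congrFun hxy (c i)
    exact ((Polynomial.finite_setOfPred_isRoot hp).preimage Complex.ofReal_injective.injOn).subset hs
  have hind : Measurable (N.indicator (1 : Matrix (Fin m) (Fin r) ℂ → ℝ≥0∞)) :=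
    measurable_one.indicator hN
  have hjoint : Measurable fun p : Matrix (Fin m) (Fin r) ℂ × ℝ => p.1 + (p.2 : ℂ) • E :=
    (continuous_fst.add ((Complex.continuous_ofReal.comp continuous_snd).smul
      continuous_const)).measurable
  -- By translation invariance every `t` contributes `volume N`, so the left side is `volume N * ∞`;
  -- the right side vanishes line by line.
  have hswap : ∫⁻ _t : ℝ, ∫⁻ X, N.indicator 1 X
      = ∫⁻ X : Matrix (Fin m) (Fin r) ℂ, ∫⁻ t : ℝ, N.indicator 1 (X + (t : ℂ) • E) := by
    rw [lintegral_lintegral_swap (f := fun X (t : ℝ) => N.indicator 1 (X + (t : ℂ) • E))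
      (hind.comp hjoint).aemeasurable]
    refine lintegral_congr fun t => ?_
    exact (lintegral_add_right_eq_self (N.indicator 1) ((t : ℂ) • E)).symm
  have hzero : ∀ X : Matrix (Fin m) (Fin r) ℂ,
      ∫⁻ t : ℝ, N.indicator 1 (X + (t : ℂ) • E) = 0 := by
    intro X
    have : ∀ᵐ t : ℝ, t ∉ {t : ℝ | X + (t : ℂ) • E ∈ N} :=
      measure_eq_zero_iff_ae_notMem.1 ((hfin X).measure_zero volume)
    refine (lintegral_congr_ae ?_).trans lintegral_zero
    filter_upwards [this] with t ht
    exact Set.indicator_of_notMem ht _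
  simp only [hzero, lintegral_zero, lintegral_const, Real.volume_univ] at hswap
  rw [lintegral_indicator_one hN] at hswap
  have h0 : volume N = 0 := by
    rcases mul_eq_zero.1 hswap with h | h
    · exact h
    · exact absurd h ENNReal.top_ne_zero
  exact measure_eq_zero_iff_ae_notMem.1 h0

end Lebesgue

/-! ### Frobenius balls: unitarily invariant sets of finite positive volume. -/

section Ball

variable {m r : ℕ}

/-- The closed ball of squared radius `R` for the Frobenius norm. -/
def frobeniusBall (m r : ℕ) (R : ℝ) : Set (Matrix (Fin m) (Fin r) ℂ) :=
  {X | (Xᴴ * X).trace.re ≤ R}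

theorem re_trace_gram (X : Matrix (Fin m) (Fin r) ℂ) :
    (Xᴴ * X).trace.re = ∑ j, ∑ i, ‖X i j‖ ^ 2 := by
  simp only [Matrix.trace, Matrix.diag, Matrix.mul_apply, Matrix.conjTranspose_apply,
    Complex.re_sum]
  refine Finset.sum_congr rfl fun j _ => Finset.sum_congr rfl fun i _ => ?_
  rw [mul_comm, Complex.star_def, Complex.mul_conj, Complex.ofReal_re, Complex.normSq_eq_norm_sq]

theorem continuous_re_trace_gram :
    Continuous fun X : Matrix (Fin m) (Fin r) ℂ => (Xᴴ * X).trace.re := by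
  fun_prop

theorem isClosed_frobeniusBall (R : ℝ) : IsClosed (frobeniusBall m r R) :=
  isClosed_le continuous_re_trace_gram continuous_const

theorem measurableSet_frobeniusBall (R : ℝ) : MeasurableSet (frobeniusBall m r R) :=
  (isClosed_frobeniusBall R).measurableSet

theorem isCompact_frobeniusBall (R : ℝ) : IsCompact (frobeniusBall m r R) := by
  have hK : IsCompact (Set.univ.pi fun _ : Fin m => Set.univ.pi fun _ : Fin r =>
      Metric.closedBall (0 : ℂ) √R) :=
    isCompact_univ_pi fun _ => isCompact_univ_pi fun _ => isCompact_closedBall _ _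
  refine hK.of_isClosed_subset (isClosed_frobeniusBall R) fun X hX i _ j _ => ?_
  rw [mem_closedBall_zero_iff]
  apply Real.le_sqrt_of_sq_le
  calc ‖X i j‖ ^ 2 ≤ ∑ i, ‖X i j‖ ^ 2 :=
        Finset.single_le_sum (f := fun i => ‖X i j‖ ^ 2) (fun _ _ => by positivity)
          (Finset.mem_univ i)
    _ ≤ ∑ j, ∑ i, ‖X i j‖ ^ 2 :=
        Finset.single_le_sum (f := fun j => ∑ i, ‖X i j‖ ^ 2) (fun _ _ => by positivity)
          (Finset.mem_univ j)
    _ ≤ R := (re_trace_gram (m := m) (r := r) X).symm.trans_le hX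

theorem volume_frobeniusBall_ne_top (R : ℝ) : volume (frobeniusBall m r R) ≠ ∞ :=
  (isCompact_frobeniusBall R).measure_lt_top.ne

theorem volume_frobeniusBall_ne_zero {R : ℝ} (hR : 0 < R) :
    volume (frobeniusBall m r R) ≠ 0 := by
  have ho : IsOpen {X : Matrix (Fin m) (Fin r) ℂ | (Xᴴ * X).trace.re < R} :=
    isOpen_lt continuous_re_trace_gram continuous_const
  have h0 : (0 : Matrix (Fin m) (Fin r) ℂ) ∈
      {X : Matrix (Fin m) (Fin r) ℂ | (Xᴴ * X).trace.re < R} := by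
    simpa using hR
  have hsub : {X : Matrix (Fin m) (Fin r) ℂ | (Xᴴ * X).trace.re < R} ⊆ frobeniusBall m r R :=
    fun X hX => (show (Xᴴ * X).trace.re < R from hX).le
  exact fun h => (ho.measure_pos volume ⟨0, h0⟩).ne' (measure_mono_null hsub h)

theorem iUnion_frobeniusBall : ⋃ n : ℕ, frobeniusBall m r ((n : ℝ) + 1) = Set.univ := by
  refine Set.eq_univ_of_forall fun X => Set.mem_iUnion.2 ?_
  obtain ⟨n, hn⟩ := exists_nat_ge (Xᴴ * X).trace.re
  exact ⟨n, show (Xᴴ * X).trace.re ≤ (n : ℝ) + 1 by linarith⟩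

theorem unitary_mul_mem_frobeniusBall_iff {U : Matrix (Fin m) (Fin m) ℂ}
    (hU : U ∈ Matrix.unitaryGroup (Fin m) ℂ) {X : Matrix (Fin m) (Fin r) ℂ} {R : ℝ} :
    U * X ∈ frobeniusBall m r R ↔ X ∈ frobeniusBall m r R := by
  have h : Uᴴ * U = 1 := Matrix.mem_unitaryGroup_iff'.1 hU
  have h2 : (U * X)ᴴ * (U * X) = Xᴴ * X := by
    rw [Matrix.conjTranspose_mul, Matrix.mul_assoc, ← Matrix.mul_assoc Uᴴ, h, Matrix.one_mul]
  simp only [frobeniusBall, Set.mem_ofPred_eq, h2]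

theorem mul_unitary_mem_frobeniusBall_iff {Q : Matrix (Fin r) (Fin r) ℂ}
    (hQ : Q ∈ Matrix.unitaryGroup (Fin r) ℂ) {X : Matrix (Fin m) (Fin r) ℂ} {R : ℝ} :
    X * Q ∈ frobeniusBall m r R ↔ X ∈ frobeniusBall m r R := by
  have h : Q * Qᴴ = 1 := Matrix.mem_unitaryGroup_iff.1 hQ
  have h2 : ((X * Q)ᴴ * (X * Q)).trace = (Xᴴ * X).trace := by
    rw [Matrix.conjTranspose_mul, Matrix.mul_assoc, Matrix.trace_mul_comm, ← Matrix.mul_assoc,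
      Matrix.mul_assoc, h, Matrix.mul_one]
  simp only [frobeniusBall, Set.mem_ofPred_eq, h2]

end Ball

/-! ### The invariant measure of the Stiefel manifold and its link to Lebesgue measure. -/

section Stiefel

variable {m r : ℕ}

/-- The Haar probability measure of the unitary group. -/
noncomputable def unitaryHaar (m : ℕ) : Measure (Matrix.unitaryGroup (Fin m) ℂ) :=
  Measure.haarMeasure (⊤ : TopologicalSpace.PositiveCompacts (Matrix.unitaryGroup (Fin m) ℂ))

instance : (unitaryHaar m).IsMulLeftInvariant :=
  inferInstanceAs (Measure.haarMeasure _).IsMulLeftInvariant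

instance : IsProbabilityMeasure (unitaryHaar m) :=
  ⟨Measure.haarMeasure_self⟩

instance (hrm : r ≤ m) : IsProbabilityMeasure (stiefelMeasure hrm) :=
  Measure.isProbabilityMeasure_map (μ := unitaryHaar m)
    (continuous_subtype_val.matrix_submatrix _ _).measurable.aemeasurable

/-- The first `r` columns of the identity matrix. -/
def stiefelBase (hrm : r ≤ m) : Matrix (Fin m) (Fin r) ℂ :=
  (1 : Matrix (Fin m) (Fin m) ℂ).submatrix id (Fin.castLE hrm)

theorem mul_stiefelBase (hrm : r ≤ m) (A : Matrix (Fin m) (Fin m) ℂ) :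
    A * stiefelBase hrm = A.submatrix id (Fin.castLE hrm) := by
  conv_rhs => rw [← Matrix.mul_one A]
  rfl

theorem measurable_unitary_coe :
    Measurable fun U : Matrix.unitaryGroup (Fin m) ℂ => (U : Matrix (Fin m) (Fin m) ℂ) :=
  measurable_subtype_coe

theorem lintegral_stiefelMeasure (hrm : r ≤ m) {F : Matrix (Fin m) (Fin r) ℂ → ℝ≥0∞}
    (hF : Measurable F) :
    ∫⁻ X, F X ∂stiefelMeasure hrm
      = ∫⁻ U, F ((U : Matrix (Fin m) (Fin m) ℂ) * stiefelBase hrm) ∂unitaryHaar m := by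
  simp only [mul_stiefelBase]
  exact lintegral_map hF (continuous_subtype_val.matrix_submatrix _ _).measurable

theorem lintegral_unitary_mul_stiefelMeasure (hrm : r ≤ m)
    {F : Matrix (Fin m) (Fin r) ℂ → ℝ≥0∞} (hF : Measurable F)
    {U : Matrix (Fin m) (Fin m) ℂ} (hU : U ∈ Matrix.unitaryGroup (Fin m) ℂ) :
    ∫⁻ X, F (U * X) ∂stiefelMeasure hrm = ∫⁻ X, F X ∂stiefelMeasure hrm := by
  rw [lintegral_stiefelMeasure hrm hF, lintegral_stiefelMeasure hrm (by fun_prop),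
    ← lintegral_mul_left_eq_self
      (fun V : Matrix.unitaryGroup (Fin m) ℂ => F ((V : Matrix (Fin m) (Fin m) ℂ) *
        stiefelBase hrm)) (⟨U, hU⟩ : Matrix.unitaryGroup (Fin m) ℂ)]
  simp only [← Matrix.mul_assoc]
  rfl

/-- Every semi-unitary matrix can be completed to a unitary one. -/
theorem exists_unitary_mul_stiefelBase (hrm : r ≤ m) {X : Matrix (Fin m) (Fin r) ℂ}
    (hX : X ∈ complexStiefel m r) :
    ∃ U ∈ Matrix.unitaryGroup (Fin m) ℂ, U * stiefelBase hrm = X := by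
  set c := Fin.castLE hrm
  have hc : Function.Injective c := Fin.castLE_injective hrm
  let col : Fin r → EuclideanSpace ℂ (Fin m) := fun j => WithLp.toLp 2 fun i => X i j
  have hcol : Orthonormal ℂ col := by
    rw [orthonormal_iff_ite]
    intro i j
    have h := congrFun (congrFun (show Xᴴ * X = 1 from hX) i) j
    rw [Matrix.mul_apply, Matrix.one_apply] at h
    rw [← h, PiLp.inner_apply]
    refine Finset.sum_congr rfl fun k _ => ?_
    simp [col, mul_comm]
  let v : Fin m → EuclideanSpace ℂ (Fin m) := Function.extend c col 0
  have hv : Orthonormal ℂ ((Set.range c).domRestrict v) := by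
    have h : (Set.range c).domRestrict v = col ∘ (Equiv.ofInjective c hc).symm := by
      funext x
      obtain ⟨y, rfl⟩ := (Equiv.ofInjective c hc).surjective x
      simp only [Function.comp_apply, Equiv.symm_apply_apply]
      exact hc.extend_apply col 0 y
    rw [h]
    exact hcol.comp _ (Equiv.injective _)
  obtain ⟨b, hb⟩ := hv.exists_orthonormalBasis_extension_of_card_eq (by simp)
  let U : Matrix (Fin m) (Fin m) ℂ := Matrix.of fun i j => b j i
  refine ⟨U, Matrix.mem_unitaryGroup_iff'.2 ?_, ?_⟩
  · ext i j
    have h := orthonormal_iff_ite.1 b.orthonormal i j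
    rw [PiLp.inner_apply] at h
    rw [Matrix.mul_apply, Matrix.one_apply, ← h]
    refine Finset.sum_congr rfl fun k _ => ?_
    simp [U, mul_comm, Matrix.star_apply]
  · rw [mul_stiefelBase]
    ext i j
    show b (c j) i = X i j
    rw [hb _ ⟨j, rfl⟩]
    show (Function.extend c col 0 (c j)) i = X i j
    rw [hc.extend_apply]

/-- Uniqueness of the left invariant measure of the Stiefel manifold. -/
theorem lintegral_eq_of_unitary_invariant (hrm : r ≤ m)
    (ν : Measure (Matrix (Fin m) (Fin r) ℂ)) [SFinite ν]
    (hν : ∀ᵐ X ∂ν, X ∈ complexStiefel m r)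
    (hinv : ∀ F : Matrix (Fin m) (Fin r) ℂ → ℝ≥0∞, Measurable F →
      ∀ U ∈ Matrix.unitaryGroup (Fin m) ℂ, ∫⁻ X, F (U * X) ∂ν = ∫⁻ X, F X ∂ν)
    {F : Matrix (Fin m) (Fin r) ℂ → ℝ≥0∞} (hF : Measurable F) :
    ∫⁻ X, F X ∂ν = ν Set.univ * ∫⁻ X, F X ∂stiefelMeasure hrm := by
  have hc : Continuous fun U : Matrix.unitaryGroup (Fin m) ℂ =>
      ((U⁻¹ : Matrix.unitaryGroup (Fin m) ℂ) : Matrix (Fin m) (Fin m) ℂ) :=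
    continuous_subtype_val.comp continuous_inv
  have hm := hc.measurable
  let J := ∫⁻ U : Matrix.unitaryGroup (Fin m) ℂ,
    F (((U⁻¹ : Matrix.unitaryGroup (Fin m) ℂ) : Matrix (Fin m) (Fin m) ℂ) * stiefelBase hrm)
      ∂unitaryHaar m
  -- The constant `J` does not depend on `μ`, so applying this to `ν` and to the Stiefel measure
  -- eliminates it.
  have key : ∀ (μ : Measure (Matrix (Fin m) (Fin r) ℂ)) [SFinite μ],
      (∀ᵐ X ∂μ, X ∈ complexStiefel m r) →
      (∀ F : Matrix (Fin m) (Fin r) ℂ → ℝ≥0∞, Measurable F →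
        ∀ U ∈ Matrix.unitaryGroup (Fin m) ℂ, ∫⁻ X, F (U * X) ∂μ = ∫⁻ X, F X ∂μ) →
      ∫⁻ X, F X ∂μ = J * μ Set.univ := by
    intro μ _ hμ hμinv
    calc ∫⁻ X, F X ∂μ = ∫⁻ _U : Matrix.unitaryGroup (Fin m) ℂ, ∫⁻ X, F X ∂μ ∂unitaryHaar m := by
          simp
      _ = ∫⁻ U : Matrix.unitaryGroup (Fin m) ℂ, ∫⁻ X,
            F (((U⁻¹ : Matrix.unitaryGroup (Fin m) ℂ) : Matrix (Fin m) (Fin m) ℂ) * X)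
              ∂μ ∂unitaryHaar m :=
          lintegral_congr fun U => (hμinv F hF _ (U⁻¹).2).symm
      _ = ∫⁻ X, ∫⁻ U : Matrix.unitaryGroup (Fin m) ℂ,
            F (((U⁻¹ : Matrix.unitaryGroup (Fin m) ℂ) : Matrix (Fin m) (Fin m) ℂ) * X)
              ∂unitaryHaar m ∂μ :=
          lintegral_lintegral_swap (Measurable.aemeasurable (by
            refine hF.comp ?_
            exact (hm.comp measurable_fst).matrix_mul_complex measurable_snd))
      _ = ∫⁻ _X, J ∂μ := by
          refine lintegral_congr_ae (hμ.mono fun X hX => ?_)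
          obtain ⟨U₀, hU₀, rfl⟩ := exists_unitary_mul_stiefelBase hrm hX
          dsimp only
          -- The inverse in `J` pays off here: `(U₀U)⁻¹U₀ = U⁻¹`, so left invariance of Haar measure
          -- suffices.
          rw [← lintegral_mul_left_eq_self _ (⟨U₀, hU₀⟩ : Matrix.unitaryGroup (Fin m) ℂ)]
          refine lintegral_congr fun U => ?_
          congr 1
          rw [mul_inv_rev, ← Matrix.mul_assoc]
          congr 1
          have h : (U⁻¹ * (⟨U₀, hU₀⟩ : Matrix.unitaryGroup (Fin m) ℂ)⁻¹) * ⟨U₀, hU₀⟩ = U⁻¹ := by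
            group
          exact congrArg Subtype.val h
      _ = J * μ Set.univ := lintegral_const _
  rw [key ν hν hinv, key (stiefelMeasure hrm) (mem_ae_iff.2 (stiefelMeasure_compl hrm))
    fun F hF U hU => lintegral_unitary_mul_stiefelMeasure hrm hF hU,
    measure_univ (μ := stiefelMeasure hrm), mul_one, mul_comm]

/-- The orientation of a matrix with a left unitarily invariant density is uniform on the
Stiefel manifold. -/
theorem lintegral_orientation_mul (hrm : r ≤ m) {F G : Matrix (Fin m) (Fin r) ℂ → ℝ≥0∞}
    (hF : Measurable F) (hG : Measurable G)
    (hGinv : ∀ U ∈ Matrix.unitaryGroup (Fin m) ℂ, ∀ X, G (U * X) = G X) :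
    ∫⁻ X, F (orientation X) * G X = (∫⁻ X, G X) * ∫⁻ X, F X ∂stiefelMeasure hrm := by
  let ν := (volume.withDensity G).map (orientation : Matrix (Fin m) (Fin r) ℂ → _)
  have hν : ∀ F : Matrix (Fin m) (Fin r) ℂ → ℝ≥0∞, Measurable F →
      ∫⁻ X, F X ∂ν = ∫⁻ X, F (orientation X) * G X := fun F hF => by
    rw [lintegral_map hF measurable_orientation]
    exact (lintegral_withDensity_eq_lintegral_mul _ hG (hF.comp measurable_orientation)).trans
      (lintegral_congr fun X => mul_comm _ _)
  have huniv : ν Set.univ = ∫⁻ X, G X := by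
    rw [← lintegral_one, hν _ measurable_const]
    simp
  rw [← hν F hF, ← huniv]
  refine lintegral_eq_of_unitary_invariant hrm ν ?_ ?_ hF
  · have hC : MeasurableSet (complexStiefel m r) :=
      (isClosed_eq (by fun_prop) continuous_const : IsClosed (complexStiefel m r)).measurableSet
    refine (ae_map_iff measurable_orientation.aemeasurable hC).2 ?_
    exact (withDensity_absolutelyContinuous _ _).ae_le
      ((ae_gramDet_ne_zero hrm).mono fun X hX => orientation_mem hX)
  · intro F hF U hU
    rw [hν F hF, hν _ (by fun_prop),
      ← lintegral_unitary_mul (F := fun X => F (orientation X) * G X) (by fun_prop) hU]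
    refine lintegral_congr fun X => ?_
    simp only [orientation_unitary_mul hU, hGinv U hU]

/-- This is the bridge between the Stiefel measure and Lebesgue measure: the ball is left unitarily
invariant and has finite volume. -/
theorem setLIntegral_orientation_frobeniusBall (hrm : r ≤ m) (R : ℝ)
    {F : Matrix (Fin m) (Fin r) ℂ → ℝ≥0∞} (hF : Measurable F) :
    ∫⁻ X, F (orientation X) * (frobeniusBall m r R).indicator 1 X
      = volume (frobeniusBall m r R) * ∫⁻ X, F X ∂stiefelMeasure hrm := by
  rw [lintegral_orientation_mul hrm hF
    (measurable_one.indicator (measurableSet_frobeniusBall R)),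
    lintegral_indicator_one (measurableSet_frobeniusBall R)]
  intro U hU X
  by_cases h : X ∈ frobeniusBall m r R <;> simp [h, unitary_mul_mem_frobeniusBall_iff hU]

/-- The construction by Haar measure shows left invariance only. Right invariance is inherited from
Lebesgue measure on a ball, since the orientation commutes with right unitary multiplication. -/
theorem lintegral_mul_unitary_stiefelMeasure (hrm : r ≤ m)
    {F : Matrix (Fin m) (Fin r) ℂ → ℝ≥0∞} (hF : Measurable F)
    {Q : Matrix (Fin r) (Fin r) ℂ} (hQ : Q ∈ Matrix.unitaryGroup (Fin r) ℂ) :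
    ∫⁻ X, F (X * Q) ∂stiefelMeasure hrm = ∫⁻ X, F X ∂stiefelMeasure hrm := by
  have hm : Measurable ((frobeniusBall m r 1).indicator (1 : Matrix (Fin m) (Fin r) ℂ → ℝ≥0∞)) :=
    measurable_one.indicator (measurableSet_frobeniusBall 1)
  rw [← ENNReal.mul_right_inj (volume_frobeniusBall_ne_zero (m := m) (r := r) one_pos)
    (volume_frobeniusBall_ne_top 1), ← setLIntegral_orientation_frobeniusBall hrm 1 hF,
    ← setLIntegral_orientation_frobeniusBall hrm 1 (by fun_prop),
    ← lintegral_mul_unitary (F := fun X => F (orientation X) * (frobeniusBall m r 1).indicator 1 X)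
      (by fun_prop) hQ]
  refine lintegral_congr fun X => ?_
  by_cases h : X ∈ frobeniusBall m r 1 <;>
    simp [h, orientation_mul_unitary hQ, mul_unitary_mem_frobeniusBall_iff hQ]

/-- The orientation map pulls null sets of the Stiefel manifold back to Lebesgue null sets. -/
theorem map_orientation_absolutelyContinuous (hrm : r ≤ m) :
    (volume : Measure (Matrix (Fin m) (Fin r) ℂ)).map orientation ≪ stiefelMeasure hrm := by
  refine Measure.AbsolutelyContinuous.mk fun N hN h0 => ?_
  -- Balls of increasing radius exhaust the space, and on each the bridge formula applies.
  rw [Measure.map_apply measurable_orientation hN, ← Set.inter_univ (orientation ⁻¹' N),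
    ← iUnion_frobeniusBall, Set.inter_iUnion, measure_iUnion_null_iff]
  intro n
  have h := setLIntegral_orientation_frobeniusBall hrm ((n : ℝ) + 1)
    (F := N.indicator 1) (measurable_one.indicator hN)
  rw [lintegral_indicator_one hN, h0, mul_zero] at h
  rw [← h, ← lintegral_indicator_one
    ((measurable_orientation hN).inter (measurableSet_frobeniusBall _))]
  refine lintegral_congr fun X => ?_
  rw [Set.inter_indicator_one]
  rfl

end Stiefel

/-! ### The change of variables for functions of the column space. -/

section ChangeOfVariables

variable {m r l : ℕ}

/-- The density `|XᴴX|^(-q)`; for `q = m` it makes Lebesgue measure on `m × r` matrices invariant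
under the right action of the general linear group. -/
noncomputable def invDensity (q : ℕ) (X : Matrix (Fin m) (Fin r) ℂ) : ℝ≥0∞ :=
  ENNReal.ofReal (gramDet X ^ (-(q : ℤ)))

/-- A compactly supported weight which depends only on the Gram matrix. -/
noncomputable def gramWeight (q : ℕ) (X : Matrix (Fin m) (Fin r) ℂ) : ℝ≥0∞ :=
  ENNReal.ofReal (gramDet X ^ q) * (frobeniusBall m r 1).indicator 1 X

@[fun_prop]
theorem measurable_invDensity (q : ℕ) :
    Measurable (invDensity q : Matrix (Fin m) (Fin r) ℂ → ℝ≥0∞) := by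
  unfold invDensity
  simp only [zpow_neg, zpow_natCast]
  exact (measurable_gramDet.pow_const q).inv.ennreal_ofReal

@[fun_prop]
theorem measurable_gramWeight (q : ℕ) :
    Measurable (gramWeight q : Matrix (Fin m) (Fin r) ℂ → ℝ≥0∞) :=
  (measurable_gramDet.pow_const q).ennreal_ofReal.mul
    (measurable_one.indicator (measurableSet_frobeniusBall 1))

theorem gramWeight_congr (q : ℕ) {X : Matrix (Fin m) (Fin r) ℂ} {Y : Matrix (Fin l) (Fin r) ℂ}
    (h : Xᴴ * X = Yᴴ * Y) : gramWeight q X = gramWeight q Y := by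
  have hb : X ∈ frobeniusBall m r 1 ↔ Y ∈ frobeniusBall l r 1 := by
    simp only [frobeniusBall, Set.mem_ofPred_eq, h]
  rw [gramWeight, gramWeight, gramDet_congr h]
  by_cases hX : X ∈ frobeniusBall m r 1
  · simp [hX, hb.1 hX]
  · simp [hX, mt hb.2 hX]

theorem gramWeight_mul_congr (q : ℕ) {X : Matrix (Fin m) (Fin r) ℂ}
    (T : Matrix (Fin r) (Fin r) ℂ) :
    gramWeight q (X * T) = gramWeight q (gramSqrt X * T) := by
  apply gramWeight_congr
  rw [Matrix.conjTranspose_mul, Matrix.conjTranspose_mul, Matrix.mul_assoc, Matrix.mul_assoc,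
    ← Matrix.mul_assoc Xᴴ, ← Matrix.mul_assoc (gramSqrt X)ᴴ, gram_gramSqrt]

theorem det_inv_ne_zero {B : Matrix (Fin m) (Fin m) ℂ} (hB : B.det ≠ 0) : B⁻¹.det ≠ 0 := by
  rw [Matrix.det_nonsing_inv, Ring.inverse_eq_inv']
  exact inv_ne_zero hB

theorem invDensity_mul (q : ℕ) {X : Matrix (Fin m) (Fin r) ℂ} {T : Matrix (Fin r) (Fin r) ℂ}
    (hT : T.det ≠ 0) :
    invDensity q X = invDensity q (X * T) * ENNReal.ofReal (‖T.det‖ ^ (2 * q)) := by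
  have h : ‖T.det‖ ≠ 0 := norm_ne_zero_iff.2 hT
  rw [invDensity, invDensity, ← ENNReal.ofReal_mul (zpow_nonneg (gramDet_nonneg _) _),
    gramDet_mul, mul_zpow, pow_mul, ← zpow_natCast (‖T.det‖ ^ 2) q, mul_assoc,
    ← zpow_add₀ (pow_ne_zero 2 h)]
  simp

theorem ofReal_inv_mul_ofReal {x : ℝ} (hx : 0 < x) :
    ENNReal.ofReal x⁻¹ * ENNReal.ofReal x = 1 := by
  rw [← ENNReal.ofReal_mul (inv_nonneg.2 hx.le), inv_mul_cancel₀ hx.ne', ENNReal.ofReal_one]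

theorem lintegral_mul_right_invDensity {F : Matrix (Fin m) (Fin r) ℂ → ℝ≥0∞} (hF : Measurable F)
    {T : Matrix (Fin r) (Fin r) ℂ} (hT : T.det ≠ 0) :
    ∫⁻ X : Matrix (Fin m) (Fin r) ℂ, F (X * T) * invDensity m X
      = ∫⁻ X, F X * invDensity m X := by
  have hpos : 0 < ‖T.det‖ ^ (2 * m) := pow_pos (norm_pos_iff.2 hT) _
  calc ∫⁻ X : Matrix (Fin m) (Fin r) ℂ, F (X * T) * invDensity m X
      = ∫⁻ X : Matrix (Fin m) (Fin r) ℂ, F (X * T) * invDensity m (X * T) *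
          ENNReal.ofReal (‖T.det‖ ^ (2 * m)) :=
        lintegral_congr fun X => by rw [invDensity_mul m hT, mul_assoc]
    _ = ∫⁻ X, F X * invDensity m X := by
        rw [lintegral_mul_const _ (by fun_prop),
          lintegral_mul_right (F := fun X => F X * invDensity m X) (by fun_prop) hT, mul_right_comm,
          ofReal_inv_mul_ofReal hpos, one_mul]

/-- For square matrices `|ST| = |TS|`, so the same density serves both sides: the general linear
group is unimodular. -/
theorem lintegral_mul_left_invDensity {F : Matrix (Fin r) (Fin r) ℂ → ℝ≥0∞} (hF : Measurable F)
    {S : Matrix (Fin r) (Fin r) ℂ} (hS : S.det ≠ 0) :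
    ∫⁻ T : Matrix (Fin r) (Fin r) ℂ, F (S * T) * invDensity r T
      = ∫⁻ T, F T * invDensity r T := by
  have hpos : 0 < ‖S.det‖ ^ (2 * r) := pow_pos (norm_pos_iff.2 hS) _
  have h : ∀ T : Matrix (Fin r) (Fin r) ℂ, invDensity r (S * T) = invDensity r (T * S) := by
    intro T
    simp only [invDensity, gramDet_square, Matrix.det_mul, mul_comm]
  calc ∫⁻ T : Matrix (Fin r) (Fin r) ℂ, F (S * T) * invDensity r T
      = ∫⁻ T : Matrix (Fin r) (Fin r) ℂ, F (S * T) * invDensity r (S * T) *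
          ENNReal.ofReal (‖S.det‖ ^ (2 * r)) :=
        lintegral_congr fun T => by rw [invDensity_mul r hS, h, mul_assoc]
    _ = ∫⁻ T, F T * invDensity r T := by
        rw [lintegral_mul_const _ (by fun_prop),
          lintegral_mul_left (F := fun T => F T * invDensity r T) (by fun_prop) hS, mul_right_comm,
          ofReal_inv_mul_ofReal hpos, one_mul]

/-- A function on `m × r` matrices which, on those of full rank, depends only on the column
space. -/
def RightInvariant (k : Matrix (Fin m) (Fin r) ℂ → ℝ≥0∞) : Prop :=
  ∀ X, gramDet X ≠ 0 → ∀ T : Matrix (Fin r) (Fin r) ℂ, T.det ≠ 0 → k (X * T) = k X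

/-- The weight sees `X` only through its Gram matrix, so `X` may be replaced by the invertible
`gramSqrt X`, which left invariance absorbs. The value is thus independent of `X`. -/
theorem lintegral_gramWeight_mul (q : ℕ) {X : Matrix (Fin m) (Fin r) ℂ} (hX : gramDet X ≠ 0) :
    ∫⁻ T : Matrix (Fin r) (Fin r) ℂ, gramWeight q (X * T) * invDensity r T
      = ∫⁻ T : Matrix (Fin r) (Fin r) ℂ, gramWeight q T * invDensity r T := by
  simp_rw +singlePass [gramWeight_mul_congr q (X := X)]
  exact lintegral_mul_left_invDensity (measurable_gramWeight q) (det_gramSqrt_ne_zero hX)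

theorem lintegral_gramWeight_mul_inv (q : ℕ) {X : Matrix (Fin m) (Fin r) ℂ}
    (hX : gramDet X ≠ 0) :
    ∫⁻ T : Matrix (Fin r) (Fin r) ℂ, gramWeight q (X * T⁻¹) * invDensity r T
      = ∫⁻ T : Matrix (Fin r) (Fin r) ℂ, gramWeight q T⁻¹ * invDensity r T := by
  have hS := det_gramSqrt_ne_zero hX
  have h : ∀ T, gramSqrt X * T⁻¹ = (T * (gramSqrt X)⁻¹)⁻¹ := fun T => by
    rw [Matrix.mul_inv_rev, Matrix.nonsing_inv_nonsing_inv _ hS.isUnit]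
  simp_rw +singlePass [gramWeight_mul_congr q (X := X), h]
  refine lintegral_mul_right_invDensity (F := fun T => gramWeight q T⁻¹) (by fun_prop)
    (det_inv_ne_zero hS)

/-- Insert the integral over `T` of the weight of `XT`, a constant, and substitute `X ↦ X T⁻¹`. The
factor `k` is unchanged, the weight of `XT` becomes that of `X`, and `B` survives only in the weight
of `B X T⁻¹`, whose integral over `T` is again constant. -/
theorem lintegral_gramWeight_comp_left_mul (hrm : r ≤ m) (q : ℕ)
    {k : Matrix (Fin m) (Fin r) ℂ → ℝ≥0∞} (hk : Measurable k) (hkinv : RightInvariant k)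
    {B : Matrix (Fin m) (Fin m) ℂ} (hB : B.det ≠ 0) :
    (∫⁻ X, k X * gramWeight q (B * X) * invDensity m X) *
        (∫⁻ T : Matrix (Fin r) (Fin r) ℂ, gramWeight q T * invDensity r T)
      = (∫⁻ X, k X * gramWeight q X * invDensity m X) *
        (∫⁻ T : Matrix (Fin r) (Fin r) ℂ, gramWeight q T⁻¹ * invDensity r T) := by
  calc (∫⁻ X, k X * gramWeight q (B * X) * invDensity m X) *
        (∫⁻ T : Matrix (Fin r) (Fin r) ℂ, gramWeight q T * invDensity r T)
      = ∫⁻ X, ∫⁻ T : Matrix (Fin r) (Fin r) ℂ, k X * gramWeight q (B * X) * invDensity m X *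
          (gramWeight q (X * T) * invDensity r T) := by
        rw [← lintegral_mul_const _ (by fun_prop)]
        refine lintegral_congr_ae ((ae_gramDet_ne_zero hrm).mono fun X hX => ?_)
        dsimp only
        rw [lintegral_const_mul _ (by fun_prop), lintegral_gramWeight_mul q hX]
    _ = ∫⁻ T : Matrix (Fin r) (Fin r) ℂ, ∫⁻ X, k X * gramWeight q (B * X) * invDensity m X *
          (gramWeight q (X * T) * invDensity r T) :=
        lintegral_lintegral_swap (Measurable.aemeasurable (by
          simp only [Function.uncurry_def]; fun_prop))
    _ = ∫⁻ T : Matrix (Fin r) (Fin r) ℂ, ∫⁻ X, k X * gramWeight q X * invDensity m X *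
          (gramWeight q (B * X * T⁻¹) * invDensity r T) := by
        refine lintegral_congr_ae ((ae_gramDet_ne_zero le_rfl).mono fun T hT => ?_)
        have hT' : T.det ≠ 0 := by
          rw [gramDet_square] at hT
          exact norm_ne_zero_iff.1 (pow_ne_zero_iff two_ne_zero |>.1 hT)
        have hTi : T⁻¹.det ≠ 0 := det_inv_ne_zero hT'
        have h := lintegral_mul_right_invDensity (T := T)
          (F := fun X => k (X * T⁻¹) * gramWeight q (B * (X * T⁻¹)) * gramWeight q X)
          (by fun_prop) hT'
        dsimp only
        simp only [← mul_assoc]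
        rw [lintegral_mul_const _ (by fun_prop), lintegral_mul_const _ (by fun_prop)]
        congr 1
        calc ∫⁻ X : Matrix (Fin m) (Fin r) ℂ,
              k X * gramWeight q (B * X) * invDensity m X * gramWeight q (X * T)
            = ∫⁻ X : Matrix (Fin m) (Fin r) ℂ,
                k (X * T * T⁻¹) * gramWeight q (B * (X * T * T⁻¹)) * gramWeight q (X * T)
                * invDensity m X := by
              refine lintegral_congr fun X => ?_
              rw [Matrix.mul_nonsing_inv_cancel_right _ _ hT'.isUnit, mul_right_comm]
          _ = _ := h
          _ = _ := by
              refine lintegral_congr_ae ((ae_gramDet_ne_zero hrm).mono fun X hX => ?_)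
              dsimp only
              rw [hkinv X hX _ hTi, Matrix.mul_assoc]
              ring
    _ = ∫⁻ X, ∫⁻ T : Matrix (Fin r) (Fin r) ℂ, k X * gramWeight q X * invDensity m X *
          (gramWeight q (B * X * T⁻¹) * invDensity r T) :=
        (lintegral_lintegral_swap (Measurable.aemeasurable (by
          simp only [Function.uncurry_def]; fun_prop))).symm
    _ = _ := by
        rw [← lintegral_mul_const _ (by fun_prop)]
        refine lintegral_congr_ae ((ae_gramDet_ne_zero hrm).mono fun X hX => ?_)
        dsimp only
        rw [lintegral_const_mul _ (by fun_prop),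
          lintegral_gramWeight_mul_inv q (gramDet_left_mul_ne_zero hB hX)]

theorem gramWeight_mul_invDensity {X : Matrix (Fin l) (Fin r) ℂ} (hX : gramDet X ≠ 0) (q p : ℕ) :
    gramWeight q X * invDensity p X
      = ENNReal.ofReal (gramDet X ^ ((q : ℤ) - p)) * (frobeniusBall l r 1).indicator 1 X := by
  rw [gramWeight, invDensity, mul_right_comm, ← ENNReal.ofReal_mul (pow_nonneg (gramDet_nonneg X) q),
    ← zpow_natCast, ← zpow_add₀ hX, sub_eq_add_neg]

/-- Needed for cancelling the constant. With weight exponent `m` the integrand is `|TᴴT|^(m-r)` on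
the ball, bounded because `r ≤ m` and positive almost everywhere. -/
theorem lintegral_gramWeight_mul_invDensity (hrm : r ≤ m) :
    (∫⁻ T : Matrix (Fin r) (Fin r) ℂ, gramWeight m T * invDensity r T) ≠ 0 ∧
    (∫⁻ T : Matrix (Fin r) (Fin r) ℂ, gramWeight m T * invDensity r T) ≠ ∞ := by
  have h : (∫⁻ T : Matrix (Fin r) (Fin r) ℂ, gramWeight m T * invDensity r T)
      = ∫⁻ T in frobeniusBall r r 1, ENNReal.ofReal (gramDet T ^ (m - r)) := by
    rw [← lintegral_indicator (measurableSet_frobeniusBall 1)]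
    refine lintegral_congr_ae ((ae_gramDet_ne_zero le_rfl).mono fun T hT => ?_)
    dsimp only
    rw [gramWeight_mul_invDensity hT, ← Nat.cast_sub hrm, zpow_natCast]
    by_cases hm : T ∈ frobeniusBall r r 1 <;> simp [hm]
  rw [h]
  constructor
  · intro h0
    have hmeas : Measurable fun T : Matrix (Fin r) (Fin r) ℂ =>
        ENNReal.ofReal (gramDet T ^ (m - r)) := by fun_prop
    rw [lintegral_eq_zero_iff hmeas] at h0
    have hfalse : ∀ᵐ T ∂(volume : Measure (Matrix (Fin r) (Fin r) ℂ)).restrict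
        (frobeniusBall r r 1), False := by
      filter_upwards [h0, ae_restrict_of_ae (ae_gramDet_ne_zero le_rfl)] with T hT hT'
      exact (ENNReal.ofReal_pos.2
        (pow_pos ((gramDet_nonneg T).lt_of_ne' hT') _)).ne' hT
    rw [Filter.eventually_false_iff_eq_bot, ae_eq_bot, Measure.restrict_eq_zero] at hfalse
    exact volume_frobeniusBall_ne_zero one_pos hfalse
  · exact (setLIntegral_lt_top_of_isCompact (volume_frobeniusBall_ne_top 1)
      (isCompact_frobeniusBall 1)
      (continuous_real_toNNReal.comp (continuous_gramDet.pow (m - r)))).ne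

/-- Off a null set `X` and its orientation have the same column space, so `k` takes the same value
at both. -/
theorem RightInvariant.lintegral_frobeniusBall (hrm : r ≤ m)
    {k : Matrix (Fin m) (Fin r) ℂ → ℝ≥0∞} (hk : Measurable k) (hkinv : RightInvariant k) :
    ∫⁻ X, k X * (frobeniusBall m r 1).indicator 1 X
      = volume (frobeniusBall m r 1) * ∫⁻ X, k X ∂stiefelMeasure hrm := by
  rw [← setLIntegral_orientation_frobeniusBall hrm 1 hk]
  refine lintegral_congr_ae ((ae_gramDet_ne_zero hrm).mono fun X hX => ?_)
  dsimp only
  conv_lhs => rw [← orientation_mul_gramSqrt hX]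
  rw [hkinv _ (by rw [gramDet_of_mem_complexStiefel (orientation_mem hX)]; exact one_ne_zero) _
    (det_gramSqrt_ne_zero hX), orientation_mul_gramSqrt hX]

/-- The change of variables `H ↦ B⁻¹ H` on the Stiefel manifold, for functions of the column
space. -/
theorem RightInvariant.lintegral_stiefelMeasure_eq (hrm : r ≤ m)
    {k : Matrix (Fin m) (Fin r) ℂ → ℝ≥0∞} (hk : Measurable k) (hkinv : RightInvariant k)
    {B : Matrix (Fin m) (Fin m) ℂ} (hB : B.det ≠ 0) :
    ∫⁻ H, k H ∂stiefelMeasure hrm = ENNReal.ofReal ((‖B.det‖ ^ (2 * r))⁻¹) *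
      ∫⁻ H, k (B⁻¹ * H) * invDensity m (B⁻¹ * H) ∂stiefelMeasure hrm := by
  have hBi : B⁻¹.det ≠ 0 := det_inv_ne_zero hB
  obtain ⟨hC0, hCtop⟩ := lintegral_gramWeight_mul_invDensity hrm
  have hv0 := volume_frobeniusBall_ne_zero (m := m) (r := r) one_pos
  have hvtop := volume_frobeniusBall_ne_top (m := m) (r := r) 1
  have hweight : ∀ᵐ X : Matrix (Fin m) (Fin r) ℂ,
      gramWeight m X * invDensity m X = (frobeniusBall m r 1).indicator 1 X :=
    (ae_gramDet_ne_zero hrm).mono fun X hX => by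
      rw [gramWeight_mul_invDensity hX]; simp
  have hint : ∀ k : Matrix (Fin m) (Fin r) ℂ → ℝ≥0∞,
      ∫⁻ X, k X * gramWeight m X * invDensity m X
        = ∫⁻ X, k X * (frobeniusBall m r 1).indicator 1 X := fun k =>
    lintegral_congr_ae (hweight.mono fun X hX => by dsimp only; rw [mul_assoc, hX])
  -- The case `k = 1`, `B = 1` of the Tonelli identity compares the two constants, since the volume
  -- of the ball cancels.
  have hCC : (∫⁻ T : Matrix (Fin r) (Fin r) ℂ, gramWeight m T * invDensity r T)
      = ∫⁻ T : Matrix (Fin r) (Fin r) ℂ, gramWeight m T⁻¹ * invDensity r T := by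
    have h := lintegral_gramWeight_comp_left_mul hrm m (k := fun _ => 1) measurable_const
      (fun _ _ _ _ => rfl) (B := 1) (by simp)
    simp only [Matrix.one_mul] at h
    rw [hint] at h
    simp only [one_mul] at h
    rw [lintegral_indicator_one (measurableSet_frobeniusBall 1)] at h
    exact (ENNReal.mul_right_inj hv0 hvtop).1 h
  have h1 := lintegral_gramWeight_comp_left_mul hrm m hk hkinv hB
  rw [← hCC, ENNReal.mul_left_inj hC0 hCtop, hint, hkinv.lintegral_frobeniusBall hrm hk] at h1
  -- The factor `gramDet Y ^ m` offsets the scaling of `invDensity m`, which makes `k₂` right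
  -- invariant; on the Stiefel manifold it equals `1`.
  let k₂ : Matrix (Fin m) (Fin r) ℂ → ℝ≥0∞ := fun Y =>
    k (B⁻¹ * Y) * invDensity m (B⁻¹ * Y) * ENNReal.ofReal (gramDet Y ^ m)
  have hk₂ : Measurable k₂ := by fun_prop
  have hk₂inv : RightInvariant k₂ := by
    intro Y hY T hT
    have hBY := gramDet_left_mul_ne_zero hBi hY
    simp only [k₂]
    rw [← Matrix.mul_assoc, hkinv _ hBY T hT, invDensity_mul m (X := B⁻¹ * Y) hT, gramDet_mul,
      mul_pow, ENNReal.ofReal_mul (pow_nonneg (gramDet_nonneg Y) m), ← pow_mul]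
    ring
  have h2 : ∫⁻ X, k X * gramWeight m (B * X) * invDensity m X
      = ENNReal.ofReal ((‖B.det‖ ^ (2 * r))⁻¹) *
        ∫⁻ Y, k₂ Y * (frobeniusBall m r 1).indicator 1 Y := by
    rw [← lintegral_mul_left (F := fun Y => k₂ Y * (frobeniusBall m r 1).indicator 1 Y)
      (hk₂.mul (measurable_one.indicator (measurableSet_frobeniusBall 1))) hB]
    refine lintegral_congr fun X => ?_
    simp only [k₂, gramWeight, Matrix.nonsing_inv_mul_cancel_left _ _ hB.isUnit]
    ring
  rw [h2, hk₂inv.lintegral_frobeniusBall hrm hk₂, mul_left_comm,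
    ENNReal.mul_right_inj hv0 hvtop] at h1
  rw [← h1]
  congr 1
  have hmem : ∀ᵐ H ∂stiefelMeasure hrm, H ∈ complexStiefel m r :=
    mem_ae_iff.2 (stiefelMeasure_compl hrm)
  refine lintegral_congr_ae (hmem.mono fun H hH => ?_)
  simp [k₂, gramDet_of_mem_complexStiefel hH]

end ChangeOfVariables

/-! ### Averaging over right unitary multiplication, and passage to general functions. -/

section Averaging

variable {m r : ℕ}

/-- The average of a function over the right action of the unitary group. -/
noncomputable def unitaryAverage (h : Matrix (Fin m) (Fin r) ℂ → ℝ≥0∞)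
    (X : Matrix (Fin m) (Fin r) ℂ) : ℝ≥0∞ :=
  ∫⁻ Q : Matrix.unitaryGroup (Fin r) ℂ, h (X * (Q : Matrix (Fin r) (Fin r) ℂ)) ∂unitaryHaar r

theorem measurable_mul_unitary_coe :
    Measurable fun p : Matrix (Fin m) (Fin r) ℂ × Matrix.unitaryGroup (Fin r) ℂ =>
      p.1 * (p.2 : Matrix (Fin r) (Fin r) ℂ) :=
  measurable_fst.matrix_mul_complex (measurable_unitary_coe.comp measurable_snd)

@[fun_prop]
theorem measurable_unitaryAverage {h : Matrix (Fin m) (Fin r) ℂ → ℝ≥0∞} (hh : Measurable h) :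
    Measurable (unitaryAverage h) :=
  (hh.comp measurable_mul_unitary_coe).lintegral_prod_right'

theorem unitaryAverage_mul_unitary (h : Matrix (Fin m) (Fin r) ℂ → ℝ≥0∞)
    (X : Matrix (Fin m) (Fin r) ℂ) {R : Matrix (Fin r) (Fin r) ℂ}
    (hR : R ∈ Matrix.unitaryGroup (Fin r) ℂ) :
    unitaryAverage h (X * R) = unitaryAverage h X := by
  unfold unitaryAverage
  rw [← lintegral_mul_left_eq_self
    (fun Q : Matrix.unitaryGroup (Fin r) ℂ => h (X * (Q : Matrix (Fin r) (Fin r) ℂ))) ⟨R, hR⟩]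
  simp only [Matrix.mul_assoc]
  rfl

/-- Replacing `X` by `XT` alters the orientation of `BX` only by a unitary factor, which `h`
ignores. Unitary invariance is thereby raised to invariance under all invertible `T`. -/
theorem rightInvariant_comp_orientation_mul {B : Matrix (Fin m) (Fin m) ℂ} (hB : B.det ≠ 0)
    {h : Matrix (Fin m) (Fin r) ℂ → ℝ≥0∞}
    (hh : ∀ X, ∀ Q ∈ Matrix.unitaryGroup (Fin r) ℂ, h (X * Q) = h X) :
    RightInvariant fun X : Matrix (Fin m) (Fin r) ℂ => h (orientation (B * X)) := by
  intro X hX T hT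
  obtain ⟨Q, hQ, h'⟩ := exists_unitary_orientation_mul (gramDet_left_mul_ne_zero hB hX) hT
  dsimp only
  rw [← Matrix.mul_assoc, h', hh _ Q hQ]

theorem rightInvariant_comp_orientation {h : Matrix (Fin m) (Fin r) ℂ → ℝ≥0∞}
    (hh : ∀ X, ∀ Q ∈ Matrix.unitaryGroup (Fin r) ℂ, h (X * Q) = h X) :
    RightInvariant fun X : Matrix (Fin m) (Fin r) ℂ => h (orientation X) := by
  simpa only [Matrix.one_mul] using rightInvariant_comp_orientation_mul (B := 1) (by simp) hh

/-- A measure on matrices that is invariant under right multiplication by unitary matrices. -/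
def IsRightUnitaryInvariant (μ : Measure (Matrix (Fin m) (Fin r) ℂ)) : Prop :=
  ∀ F : Matrix (Fin m) (Fin r) ℂ → ℝ≥0∞, Measurable F →
    ∀ Q ∈ Matrix.unitaryGroup (Fin r) ℂ, ∫⁻ X, F (X * Q) ∂μ = ∫⁻ X, F X ∂μ

theorem isRightUnitaryInvariant_stiefelMeasure (hrm : r ≤ m) :
    IsRightUnitaryInvariant (stiefelMeasure hrm) :=
  fun _ hF _ hQ => lintegral_mul_unitary_stiefelMeasure hrm hF hQ

/-- By Tonelli the average is an integral over `Q` of terms that all agree: the factor `Q` moves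
through `g` into the argument and `μ` absorbs it. -/
theorem IsRightUnitaryInvariant.lintegral_unitaryAverage
    {μ : Measure (Matrix (Fin m) (Fin r) ℂ)} [SFinite μ] (hμ : IsRightUnitaryInvariant μ)
    {h D : Matrix (Fin m) (Fin r) ℂ → ℝ≥0∞} (hh : Measurable h) (hD : Measurable D)
    (hDinv : ∀ X, ∀ Q ∈ Matrix.unitaryGroup (Fin r) ℂ, D (X * Q) = D X)
    {g : Matrix (Fin m) (Fin r) ℂ → Matrix (Fin m) (Fin r) ℂ} (hg : Measurable g)
    (hgeq : ∀ X, ∀ Q ∈ Matrix.unitaryGroup (Fin r) ℂ, g (X * Q) = g X * Q) :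
    ∫⁻ X, unitaryAverage h (g X) * D X ∂μ = ∫⁻ X, h (g X) * D X ∂μ := by
  have hm : Measurable fun p : Matrix (Fin m) (Fin r) ℂ × Matrix.unitaryGroup (Fin r) ℂ =>
      h (g p.1 * (p.2 : Matrix (Fin r) (Fin r) ℂ)) :=
    hh.comp (measurable_mul_unitary_coe.comp
      ((hg.comp measurable_fst).prodMk measurable_snd))
  calc ∫⁻ X, unitaryAverage h (g X) * D X ∂μ
      = ∫⁻ X, ∫⁻ Q : Matrix.unitaryGroup (Fin r) ℂ,
          h (g X * (Q : Matrix (Fin r) (Fin r) ℂ)) * D X ∂unitaryHaar r ∂μ :=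
        lintegral_congr fun X =>
          (lintegral_mul_const _ (hm.comp (measurable_const.prodMk measurable_id))).symm
    _ = ∫⁻ Q : Matrix.unitaryGroup (Fin r) ℂ, ∫⁻ X,
          h (g X * (Q : Matrix (Fin r) (Fin r) ℂ)) * D X ∂μ ∂unitaryHaar r :=
        lintegral_lintegral_swap (hm.mul (hD.comp measurable_fst)).aemeasurable
    _ = ∫⁻ _Q : Matrix.unitaryGroup (Fin r) ℂ, ∫⁻ X, h (g X) * D X ∂μ ∂unitaryHaar r := by
        refine lintegral_congr fun Q => ?_
        rw [← hμ (fun X => h (g X) * D X) (by fun_prop) Q Q.2]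
        simp only [hgeq _ _ Q.2, hDinv _ _ Q.2]
    _ = ∫⁻ X, h (g X) * D X ∂μ := by simp

theorem ae_mem_complexStiefel (hrm : r ≤ m) :
    ∀ᵐ H ∂stiefelMeasure hrm, H ∈ complexStiefel m r :=
  mem_ae_iff.2 (stiefelMeasure_compl hrm)

/-- The map `H ↦ orientation (B⁻¹ H)` preserves null sets of the Stiefel manifold. -/
theorem quasiMeasurePreserving_orientation_inv_mul (hrm : r ≤ m) {B : Matrix (Fin m) (Fin m) ℂ}
    (hB : B.det ≠ 0) :
    Measure.QuasiMeasurePreserving (fun H => orientation (B⁻¹ * H)) (stiefelMeasure hrm)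
      (stiefelMeasure hrm) := by
  refine ⟨by fun_prop, Measure.AbsolutelyContinuous.mk fun N hN h0 => ?_⟩
  set h : Matrix (Fin m) (Fin r) ℂ → ℝ≥0∞ := N.indicator 1
  have hh : Measurable h := measurable_one.indicator hN
  have hσ := isRightUnitaryInvariant_stiefelMeasure hrm
  have havg := unitaryAverage_mul_unitary h
  -- The set `N` need not be right invariant, so the change of variables is applied to its averaged
  -- indicator, which still has integral zero.
  have h1 : ∫⁻ H, unitaryAverage h (orientation H) ∂stiefelMeasure hrm = 0 := by
    have h2 := hσ.lintegral_unitaryAverage hh (measurable_const (a := 1)) (fun _ _ _ => rfl)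
      measurable_id (fun _ _ _ => rfl)
    simp only [mul_one, id] at h2
    rw [lintegral_indicator_one hN, h0] at h2
    rw [← h2]
    refine lintegral_congr_ae ((ae_mem_complexStiefel hrm).mono fun H hH => ?_)
    dsimp only
    rw [orientation_of_mem hH]
  rw [(rightInvariant_comp_orientation fun X _ hQ => havg X hQ).lintegral_stiefelMeasure_eq hrm
    (by fun_prop) hB, mul_eq_zero, or_iff_right, lintegral_eq_zero_iff (by fun_prop)] at h1
  · rw [Measure.map_apply (by fun_prop) hN]
    have h3 := hσ.lintegral_unitaryAverage hh (measurable_const (a := 1)) (fun _ _ _ => rfl)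
      (g := fun H => orientation (B⁻¹ * H)) (by fun_prop) fun X Q hQ => by
        rw [← Matrix.mul_assoc, orientation_mul_unitary hQ]
    simp only [mul_one] at h3
    have h4 : ∫⁻ H, h (orientation (B⁻¹ * H)) ∂stiefelMeasure hrm
        = stiefelMeasure hrm ((fun H => orientation (B⁻¹ * H)) ⁻¹' N) := by
      rw [← lintegral_indicator_one ((by fun_prop : Measurable fun
        H : Matrix (Fin m) (Fin r) ℂ => orientation (B⁻¹ * H)) hN)]
      rfl
    rw [← h4, ← h3]
    refine (lintegral_congr_ae ?_).trans lintegral_zero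
    filter_upwards [h1, ae_mem_complexStiefel hrm] with H hH hmem
    refine (mul_eq_zero.1 hH).resolve_right (ENNReal.ofReal_pos.2 (zpow_pos ?_ _)).ne'
    refine (gramDet_nonneg _).lt_of_ne' (gramDet_left_mul_ne_zero (det_inv_ne_zero hB) ?_)
    rw [gramDet_of_mem_complexStiefel hmem]
    exact one_ne_zero
  · exact (ENNReal.ofReal_pos.2 (inv_pos.2 (pow_pos (norm_pos_iff.2 hB) _))).ne'

/-- A density of the orientation of a right unitarily invariant law agrees almost everywhere with
its unitary average. -/
theorem unitaryAverage_ae_eq (hrm : r ≤ m) {μ : Measure (Matrix (Fin m) (Fin r) ℂ)}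
    [IsFiniteMeasure μ] (hμ : IsRightUnitaryInvariant μ)
    {f : Matrix (Fin m) (Fin r) ℂ → ℝ≥0∞} (hf : Measurable f)
    (hfμ : μ.map orientation = (stiefelMeasure hrm).withDensity f) :
    unitaryAverage f =ᵐ[stiefelMeasure hrm] f := by
  have hlaw : ∀ F : Matrix (Fin m) (Fin r) ℂ → ℝ≥0∞, Measurable F →
      ∫⁻ H, f H * F H ∂stiefelMeasure hrm = ∫⁻ X, F (orientation X) ∂μ := fun F hF => by
    rw [← lintegral_map hF measurable_orientation, hfμ]
    exact (lintegral_withDensity_eq_lintegral_mul _ hf hF).symm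
  have hfin : ∫⁻ H, f H ∂stiefelMeasure hrm ≠ ∞ := by
    have h := hlaw (fun _ => 1) measurable_const
    simp only [mul_one, lintegral_const, one_mul] at h
    rw [h]
    exact measure_ne_top μ _
  have hσ := isRightUnitaryInvariant_stiefelMeasure hrm
  -- The law of the orientation is itself right invariant, so averaging `f` gives the same measure;
  -- finite mass then identifies the densities almost everywhere.
  have heq : (stiefelMeasure hrm).withDensity f
      = (stiefelMeasure hrm).withDensity (unitaryAverage f) := by
    ext A hA
    have hind : Measurable (A.indicator (1 : Matrix (Fin m) (Fin r) ℂ → ℝ≥0∞)) :=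
      measurable_one.indicator hA
    have hset : ∀ u : Matrix (Fin m) (Fin r) ℂ → ℝ≥0∞,
        (stiefelMeasure hrm).withDensity u A
          = ∫⁻ H, u H * A.indicator 1 H ∂stiefelMeasure hrm := fun u => by
      rw [withDensity_apply _ hA, ← lintegral_indicator hA]
      refine lintegral_congr fun H => ?_
      by_cases hH : H ∈ A <;> simp [hH]
    rw [hset, hset]
    symm
    calc ∫⁻ H, unitaryAverage f H * A.indicator 1 H ∂stiefelMeasure hrm
        = ∫⁻ H, ∫⁻ Q : Matrix.unitaryGroup (Fin r) ℂ,
            f (H * (Q : Matrix (Fin r) (Fin r) ℂ)) * A.indicator 1 H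
              ∂unitaryHaar r ∂stiefelMeasure hrm :=
          lintegral_congr fun H => (lintegral_mul_const _
            (hf.comp (measurable_mul_unitary_coe.comp
              (measurable_const.prodMk measurable_id)))).symm
      _ = ∫⁻ Q : Matrix.unitaryGroup (Fin r) ℂ, ∫⁻ H,
            f (H * (Q : Matrix (Fin r) (Fin r) ℂ)) * A.indicator 1 H
              ∂stiefelMeasure hrm ∂unitaryHaar r :=
          lintegral_lintegral_swap ((hf.comp measurable_mul_unitary_coe).mul
            (hind.comp measurable_fst)).aemeasurable
      _ = ∫⁻ _Q : Matrix.unitaryGroup (Fin r) ℂ,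
            ∫⁻ H, f H * A.indicator 1 H ∂stiefelMeasure hrm ∂unitaryHaar r := by
          refine lintegral_congr fun Q => ?_
          set R : Matrix (Fin r) (Fin r) ℂ := star (Q : Matrix (Fin r) (Fin r) ℂ)
          have hR : R ∈ Matrix.unitaryGroup (Fin r) ℂ := Unitary.star_mem Q.2
          have hQR : (Q : Matrix (Fin r) (Fin r) ℂ) * R = 1 := Matrix.mem_unitaryGroup_iff.1 Q.2
          -- The factor `Q` is moved from `f` to the indicator as `R = Q*`, where it can be removed
          -- through the invariance of `μ`.
          calc ∫⁻ H, f (H * (Q : Matrix (Fin r) (Fin r) ℂ)) * A.indicator 1 H ∂stiefelMeasure hrm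
              = ∫⁻ H, f H * A.indicator 1 (H * R) ∂stiefelMeasure hrm := by
                rw [← hσ (fun H => f H * A.indicator 1 (H * R)) (by fun_prop) Q Q.2]
                simp only [Matrix.mul_assoc, hQR, Matrix.mul_one]
            _ = ∫⁻ X, A.indicator 1 (orientation (X * R)) ∂μ := by
                rw [hlaw (fun H => A.indicator 1 (H * R)) (by fun_prop)]
                simp only [orientation_mul_unitary hR]
            _ = ∫⁻ X, A.indicator 1 (orientation X) ∂μ :=
                hμ (fun X => A.indicator 1 (orientation X)) (by fun_prop) R hR
            _ = ∫⁻ H, f H * A.indicator 1 H ∂stiefelMeasure hrm := (hlaw _ hind).symm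
      _ = ∫⁻ H, f H * A.indicator 1 H ∂stiefelMeasure hrm := by simp
  exact ((withDensity_eq_iff hf.aemeasurable (by fun_prop) hfin).1 heq).symm

/-- The density of the orientation of `B X` for a right unitarily invariant law of `X`. -/
theorem map_orientation_mul_eq_withDensity (hrm : r ≤ m)
    {μ : Measure (Matrix (Fin m) (Fin r) ℂ)} [IsFiniteMeasure μ] (hac : μ ≪ volume)
    (hμ : IsRightUnitaryInvariant μ)
    {f : Matrix (Fin m) (Fin r) ℂ → ℝ≥0∞} (hf : AEMeasurable f (stiefelMeasure hrm))
    (hfμ : μ.map orientation = (stiefelMeasure hrm).withDensity f)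
    {B : Matrix (Fin m) (Fin m) ℂ} (hB : B.det ≠ 0) :
    AEMeasurable (fun H => ENNReal.ofReal ((‖B.det‖ ^ (2 * r))⁻¹) * invDensity m (B⁻¹ * H) *
        f (orientation (B⁻¹ * H))) (stiefelMeasure hrm) ∧
    μ.map (fun X : Matrix (Fin m) (Fin r) ℂ => orientation (B * X)) = (stiefelMeasure hrm).withDensity
      (fun H => ENNReal.ofReal ((‖B.det‖ ^ (2 * r))⁻¹) * invDensity m (B⁻¹ * H) *
        f (orientation (B⁻¹ * H))) := by
  set c := ENNReal.ofReal ((‖B.det‖ ^ (2 * r))⁻¹)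
  have hf₀ := hf.measurable_mk
  set f₁ := unitaryAverage (hf.mk f)
  have hf₁ : Measurable f₁ := by fun_prop
  have hf₁inv : ∀ X, ∀ Q ∈ Matrix.unitaryGroup (Fin r) ℂ, f₁ (X * Q) = f₁ X :=
    fun X Q hQ => unitaryAverage_mul_unitary _ X hQ
  have hff₁ : f =ᵐ[stiefelMeasure hrm] f₁ := hf.ae_eq_mk.trans
    (unitaryAverage_ae_eq hrm hμ hf₀ (hfμ.trans (withDensity_congr_ae hf.ae_eq_mk))).symm
  have hlaw : ∀ F : Matrix (Fin m) (Fin r) ℂ → ℝ≥0∞, Measurable F →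
      ∫⁻ X, F (orientation X) ∂μ = ∫⁻ H, F H * f₁ H ∂stiefelMeasure hrm := fun F hF => by
    rw [← lintegral_map hF measurable_orientation, hfμ, withDensity_congr_ae hff₁]
    exact (lintegral_withDensity_eq_lintegral_mul _ hf₁ hF).trans
      (lintegral_congr fun X => mul_comm _ _)
  set D : Matrix (Fin m) (Fin r) ℂ → ℝ≥0∞ := fun H =>
    c * invDensity m (B⁻¹ * H) * f₁ (orientation (B⁻¹ * H))
  have hD : Measurable D := by fun_prop
  have hDinv : ∀ X, ∀ Q ∈ Matrix.unitaryGroup (Fin r) ℂ, D (X * Q) = D X := fun X Q hQ => by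
    simp only [D]
    rw [← Matrix.mul_assoc, orientation_mul_unitary hQ, hf₁inv _ Q hQ, invDensity, invDensity,
      gramDet_mul, norm_det_of_mem_unitaryGroup hQ, one_pow, mul_one]
  -- Equality of `f` and `f₁` almost everywhere survives composition with `H ↦ orientation (B⁻¹ *
  -- H)` because that map is quasi measure preserving.
  have hDae : (fun H => c * invDensity m (B⁻¹ * H) * f (orientation (B⁻¹ * H)))
      =ᵐ[stiefelMeasure hrm] D :=
    ((quasiMeasurePreserving_orientation_inv_mul hrm hB).ae_eq hff₁).mono fun H hH => by
      simp only [D]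
      congr 1
  refine ⟨⟨D, hD, hDae⟩, ?_⟩
  rw [withDensity_congr_ae hDae]
  have hσ := isRightUnitaryInvariant_stiefelMeasure hrm
  have hBm : Measurable fun X : Matrix (Fin m) (Fin r) ℂ => orientation (B * X) := by fun_prop
  ext A hA
  set h : Matrix (Fin m) (Fin r) ℂ → ℝ≥0∞ := A.indicator 1
  have hh : Measurable h := measurable_one.indicator hA
  set ψ : Matrix (Fin m) (Fin r) ℂ → ℝ≥0∞ := fun X => unitaryAverage h (orientation (B * X))
  have hψ : Measurable ψ := by fun_prop
  have hψinv : RightInvariant ψ :=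
    rightInvariant_comp_orientation_mul hB fun X Q hQ => unitaryAverage_mul_unitary h X hQ
  have hk : RightInvariant fun X => ψ X * f₁ (orientation X) := fun X hX T hT => by
    have h2 := rightInvariant_comp_orientation hf₁inv X hX T hT
    dsimp only at h2 ⊢
    rw [hψinv X hX T hT, h2]
  calc μ.map (fun X : Matrix (Fin m) (Fin r) ℂ => orientation (B * X)) A
      = ∫⁻ X, h (orientation (B * X)) ∂μ := by
        rw [← lintegral_indicator_one hA, lintegral_map hh hBm]
    _ = ∫⁻ X, ψ X ∂μ := by
        have h2 := hμ.lintegral_unitaryAverage hh (measurable_const (a := 1)) (fun _ _ _ => rfl)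
          hBm fun X Q hQ => by rw [← Matrix.mul_assoc, orientation_mul_unitary hQ]
        simp only [mul_one] at h2
        exact h2.symm
    _ = ∫⁻ X, ψ (orientation X) ∂μ := by
        refine lintegral_congr_ae ((Filter.Eventually.filter_mono hac.ae_le
          (ae_gramDet_ne_zero hrm)).mono fun X hX => ?_)
        have h2 := hψinv (orientation X)
          (by rw [gramDet_of_mem_complexStiefel (orientation_mem hX)]; exact one_ne_zero) _
          (det_gramSqrt_ne_zero hX)
        rwa [orientation_mul_gramSqrt hX] at h2
    -- The orientation is the identity on the manifold. Inserting it makes the integrand right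
    -- invariant on all full-rank matrices, as the change of variables requires.
    _ = ∫⁻ H, ψ H * f₁ (orientation H) ∂stiefelMeasure hrm := by
        rw [hlaw ψ hψ]
        refine lintegral_congr_ae ((ae_mem_complexStiefel hrm).mono fun H hH => ?_)
        dsimp only
        rw [orientation_of_mem hH]
    _ = ∫⁻ H, unitaryAverage h H * D H ∂stiefelMeasure hrm := by
        rw [hk.lintegral_stiefelMeasure_eq hrm (by fun_prop) hB,
          ← lintegral_const_mul _ (by fun_prop)]
        refine lintegral_congr_ae ((ae_mem_complexStiefel hrm).mono fun H hH => ?_)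
        simp only [ψ, D, Matrix.mul_nonsing_inv_cancel_left _ _ hB.isUnit, orientation_of_mem hH]
        ring
    _ = ∫⁻ H, h H * D H ∂stiefelMeasure hrm :=
        hσ.lintegral_unitaryAverage hh hD hDinv measurable_id fun _ _ _ => rfl
    _ = (stiefelMeasure hrm).withDensity D A := by
        rw [withDensity_apply _ hA, ← lintegral_indicator hA]
        refine lintegral_congr fun H => ?_
        by_cases hH : H ∈ A <;> simp [h, hH]

/-- Right multiplication by `Q` preserves Lebesgue measure, so it also preserves the null set where
`f` differs from its measurable version. -/
theorem isRightUnitaryInvariant_withDensity {f : Matrix (Fin m) (Fin r) ℂ → ℝ≥0∞}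
    (hf : AEMeasurable f)
    (hinv : ∀ Q ∈ Matrix.unitaryGroup (Fin r) ℂ,
      ∀ᵐ X : Matrix (Fin m) (Fin r) ℂ, f (X * Q) = f X) :
    IsRightUnitaryInvariant ((volume : Measure (Matrix (Fin m) (Fin r) ℂ)).withDensity f) := by
  intro F hF Q hQ
  have hmp : MeasurePreserving (fun X : Matrix (Fin m) (Fin r) ℂ => X * Q) := by
    refine ⟨by fun_prop, ?_⟩
    ext A hA
    rw [← lintegral_indicator_one hA, ← lintegral_indicator_one hA,
      lintegral_map (measurable_one.indicator hA) (by fun_prop)]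
    exact lintegral_mul_unitary (measurable_one.indicator hA) hQ
  have hae := hmp.quasiMeasurePreserving.ae_eq hf.ae_eq_mk
  have hmk := hf.measurable_mk
  have h : ∀ G : Matrix (Fin m) (Fin r) ℂ → ℝ≥0∞, Measurable G →
      ∫⁻ X, G X ∂(volume : Measure (Matrix (Fin m) (Fin r) ℂ)).withDensity f
        = ∫⁻ X, hf.mk f X * G X := fun G hG => by
    rw [withDensity_congr_ae hf.ae_eq_mk]
    exact lintegral_withDensity_eq_lintegral_mul _ hmk hG
  rw [h F hF, h _ (by fun_prop), ← lintegral_mul_unitary (F := fun X => hf.mk f X * F X)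
    (by fun_prop) hQ]
  refine lintegral_congr_ae ?_
  filter_upwards [hae, hf.ae_eq_mk, hinv Q hQ] with X h1 h2 h3
  simp only [Function.comp_apply] at h1
  rw [← h1, h3, h2]

end Averaging

/-! ### From laws to random matrices. -/

theorem HasDensity.comp_hasLaw {Ω E E' : Type*} [MeasurableSpace Ω] [MeasurableSpace E]
    [MeasurableSpace E'] {X : Ω → E} {P : Measure Ω} {μ : Measure E} {ν : Measure E'}
    {f : E → ℝ≥0∞} {g : E' → ℝ≥0∞} (hX : HasDensity X P μ f) {φ : E → E'} (hφ : Measurable φ)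
    (hg : AEMeasurable g ν) (h : (μ.withDensity f).map φ = ν.withDensity g) :
    HasDensity (fun ω => φ (X ω)) P ν g := by
  refine ⟨hg, ⟨hφ.comp_aemeasurable hX.hasLaw.aemeasurable, ?_⟩⟩
  rw [← h, ← hX.hasLaw.map_eq]
  exact (AEMeasurable.map_map_of_aemeasurable hφ.aemeasurable hX.hasLaw.aemeasurable).symm

theorem mainTheorem3 {Ω : Type*} [MeasurableSpace Ω] (P : Measure Ω) [IsProbabilityMeasure P]
    {m r : ℕ} (hrm : r ≤ m)
    (Z : Ω → Matrix (Fin m) (Fin r) ℂ) (fZ : Matrix (Fin m) (Fin r) ℂ → ℝ≥0∞)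
    (hZ : HasDensity Z P volume fZ)
    (hinv : ∀ Q ∈ Matrix.unitaryGroup (Fin r) ℂ,
      ∀ᵐ X : Matrix (Fin m) (Fin r) ℂ, fZ (X * Q) = fZ X)
    (B : Matrix (Fin m) (Fin m) ℂ) (hB : B.det ≠ 0) :
    (∃ f : Matrix (Fin m) (Fin r) ℂ → ℝ≥0∞,
      HasDensity (fun ω => orientation (Z ω)) P (stiefelMeasure hrm) f) ∧
    ∀ f : Matrix (Fin m) (Fin r) ℂ → ℝ≥0∞,
      HasDensity (fun ω => orientation (Z ω)) P (stiefelMeasure hrm) f →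
      HasDensity (fun ω => orientation (B * Z ω)) P (stiefelMeasure hrm)
        (fun H =>
          let W := B⁻¹ * H
          ENNReal.ofReal
              (‖(Bᴴ * B).det‖ ^ (-(r : ℤ)) * ‖(Wᴴ * W).det‖ ^ (-(m : ℤ))) *
            f (orientation W)) := by
  set μ := (volume : Measure (Matrix (Fin m) (Fin r) ℂ)).withDensity fZ
  have hmap : P.map Z = μ := hZ.hasLaw.map_eq
  have hfin : IsProbabilityMeasure μ :=
    hmap ▸ Measure.isProbabilityMeasure_map hZ.hasLaw.aemeasurable
  have hac : μ ≪ volume := withDensity_absolutelyContinuous _ _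
  have hμ := isRightUnitaryInvariant_withDensity hZ.aemeasurable hinv
  constructor
  -- Existence is Radon–Nikodym, from absolute continuity alone.
  · have hacσ : μ.map orientation ≪ stiefelMeasure hrm :=
      (hac.map measurable_orientation).trans (map_orientation_absolutelyContinuous hrm)
    exact ⟨_, hZ.comp_hasLaw measurable_orientation (Measure.measurable_rnDeriv _ _).aemeasurable
      (Measure.withDensity_rnDeriv_eq _ _ hacσ).symm⟩
  · intro f hf
    have hfμ : μ.map orientation = (stiefelMeasure hrm).withDensity f := by
      rw [← hf.hasLaw.map_eq, ← hmap]
      exact AEMeasurable.map_map_of_aemeasurable measurable_orientation.aemeasurable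
        hZ.hasLaw.aemeasurable
    obtain ⟨h1, h2⟩ := map_orientation_mul_eq_withDensity hrm hac hμ hf.aemeasurable hfμ hB
    -- Gram determinants are nonnegative reals, so the norms in the statement are the determinants
    -- themselves; `|B*B| = |det B|^2` matches the two forms.
    have hcoef : ∀ W : Matrix (Fin m) (Fin r) ℂ,
        ENNReal.ofReal (‖(Bᴴ * B).det‖ ^ (-(r : ℤ)) * ‖(Wᴴ * W).det‖ ^ (-(m : ℤ)))
          = ENNReal.ofReal ((‖B.det‖ ^ (2 * r))⁻¹) * invDensity m W := fun W => by
      rw [ENNReal.ofReal_mul (zpow_nonneg (norm_nonneg _) _), invDensity, gramDet,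
        ← gramDet, gramDet_square, zpow_neg, zpow_natCast, pow_mul]
    simp only [hcoef]
    exact hZ.comp_hasLaw (φ := fun X => orientation (B * X)) (by fun_prop) h1 h2
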